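/- All manifolds and (complex) vector fields are smooth. A CR manifold $(M,D,J)$ of type $(n,k)$ is a manifold of dimension $2n+k$ with a distribution $D\subseteq TM$ of rank $2n$ and a smooth field of endomorphisms $J\colon D\to D$, $J^2=-\mathrm{id}$, whose $-\mathrm i$ eigendistribution $D^{0,1}\subset \mathbb C\otimes D$ is involutive; $\mathfrak X^{0,1}$ denotes the space of sections of $D^{0,1}$. A CR embedding $F$ of $(M,D,J)$ into $(\tilde M,\tilde D,\tilde J)$ is a smooth embedding with $F_*D\subseteq\tilde D$ and $F_*J=\tilde JF_*$ on $D$. **Theorem.** Let $(M,D,J)$ be a CR manifold of type $(n,k)$, and let $X_1,\dots,X_s$ be nowhere vanishing complex vector fields on $M$ with $[X_\alpha,\mathfrak X^{0,1}]\subseteq\mathfrak X^{0,1}$ and $$[X_\alpha,X_\beta]=\sum_\gamma c_{\alpha\beta}^\gamma X_\gamma \mod \mathfrak X^{0,1}$$ with complex constants $c_{\alpha\beta}^\gamma$. Suppose that $E_x=D^{0,1}_x+\operatorname{span}_{\mathbb C}\{X_1(x),\dots,X_s(x)\}$ has complex dimension $n+\ell$ for every $x\in M$. Let $p\in M$ be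 a point at which the extension is transverse to $D$, that is, $E_p\cap(\mathbb C\otimes D_p)=D^{0,1}_p$. Then $\ell\le k$, and a neighbourhood of $p$ has a CR embedding into a CR manifold of type $(n+\ell,k-\ell)$. More precisely, there are an open neighbourhood $U$ of $p$ in $M$, an open neighbourhood $V$ of $0$ in $\mathbb R^\ell$, distinct indices $\sigma(1),\dots,\sigma(\ell)\in\{1,\dots,s\}$, numbers $\varepsilon_1,\dots,\varepsilon_\ell\in\{1,\mathrm i\}$, and a CR structure of type $(n+\ell,k-\ell)$ on $U\times V$ such that $q\mapsto(q,0)$ is a CR embedding of $U$ into $U\times V$, and such that the $(0,1)$-space of $U\times V$ at each $(q,t)$ is spanned by the lift of $D^{0,1}_q$ and the values at $(q,t)$ of $$Y_\alpha=\sum_{\gamma=1}^s\lambda_\alpha^\gamma(t)\,X_\gamma+\mathrm i\,\frac{\partial}{\partial t^\alpha},\qquad \alpha=1,\dots,\ell .$$ Here $\lambda_\alpha(t)=(\lambda_\alpha^1(t),\dots,\lambda_\alpha^s(t))=\omega_\alpha(-\mathrm i t)$, where, with $\xi_1,\dots,\xi_s$ the standard basis of $\mathbb C^s$, $\eta_\alpha=\varepsilon_\alpha\xi_{\sigma(\alpha)}$,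 and $\operatorname{ad}$ the bilinear extension of $\operatorname{ad}(\xi_\mu)\xi_\nu=\sum_\gamma c_{\mu\nu}^\gamma\xi_\gamma$, $$\omega_\alpha(\tau)=e^{-\tau^1\operatorname{ad}\eta_1}\cdots e^{-\tau^{\alpha-1}\operatorname{ad}\eta_{\alpha-1}}\,\eta_\alpha$$ (when the $c_{\mu\nu}^\gamma$ are the structure constants of a Lie algebra with basis $\xi_1,\dots,\xi_s$, this is the $d\tau^\alpha$ component of the left-invariant Maurer–Cartan form in the exponential coordinates of the second kind $g=\cdots\exp(\tau^2\eta_2)\exp(\tau^1\eta_1)$). -/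

import Mathlib

open Set Manifold
open scoped ContDiff Topology Matrix

/-! ### Complexification of a real vector space -/

/-- The complexification `V ⊕ iV` of a real vector space; the element with real part `a` and
imaginary part `b` stands for `a + i b`. -/
@[ext]
structure ComplexVec (V : Type*) where
  re : V
  im : V

namespace ComplexVec

variable {V W : Type*} [AddCommGroup V]

instance : Zero (ComplexVec V) := ⟨⟨0, 0⟩⟩
instance : Add (ComplexVec V) := ⟨fun z w => ⟨z.re + w.re, z.im + w.im⟩⟩
instance : Neg (ComplexVec V) := ⟨fun z => ⟨-z.re, -z.im⟩⟩

@[simp] theorem zero_re : (0 : ComplexVec V).re = 0 := rfl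
@[simp] theorem zero_im : (0 : ComplexVec V).im = 0 := rfl
@[simp] theorem add_re (z w : ComplexVec V) : (z + w).re = z.re + w.re := rfl
@[simp] theorem add_im (z w : ComplexVec V) : (z + w).im = z.im + w.im := rfl
@[simp] theorem neg_re (z : ComplexVec V) : (-z).re = -z.re := rfl
@[simp] theorem neg_im (z : ComplexVec V) : (-z).im = -z.im := rfl
variable [Module ℝ V] [AddCommGroup W] [Module ℝ W]

/-- `(x + i y) • (a + i b) = (x a - y b) + i (x b + y a)`. -/
instance : SMul ℂ (ComplexVec V) :=
  ⟨fun c z => ⟨c.re • z.re - c.im • z.im, c.re • z.im + c.im • z.re⟩⟩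

@[simp] theorem smul_re (c : ℂ) (z : ComplexVec V) :
    (c • z).re = c.re • z.re - c.im • z.im := rfl
@[simp] theorem smul_im (c : ℂ) (z : ComplexVec V) :
    (c • z).im = c.re • z.im + c.im • z.re := rfl

instance : AddCommGroup (ComplexVec V) where
  add_assoc _ _ _ := by ext <;> simp [add_assoc]
  zero_add _ := by ext <;> simp
  add_zero _ := by ext <;> simp
  add_comm _ _ := by ext <;> simp [add_comm]
  neg_add_cancel _ := by ext <;> simp
  nsmul := nsmulRec
  zsmul := zsmulRec

instance : Module ℂ (ComplexVec V) where
  one_smul _ := by ext <;> simp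
  mul_smul _ _ _ := by ext <;> simp <;> module
  smul_zero _ := by ext <;> simp
  smul_add _ _ _ := by ext <;> simp <;> module
  add_smul _ _ _ := by ext <;> simp <;> module
  zero_smul _ := by ext <;> simp

/-- The complex-linear extension of a real-linear map. -/
def map (f : V →ₗ[ℝ] W) : ComplexVec V →ₗ[ℂ] ComplexVec W where
  toFun z := ⟨f z.re, f z.im⟩
  map_add' _ _ := by ext <;> simp
  map_smul' _ _ := by ext <;> simp

end ComplexVec

/-! ### Complex vector fields -/

section VectorFields

variable {E H N : Type*} [NormedAddCommGroup E] [NormedSpace ℝ E] [TopologicalSpace H]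
  (I : ModelWithCorners ℝ E H) [TopologicalSpace N] [ChartedSpace H N]

/-- The real vector field `A` is smooth on the set `u`. -/
def SmoothFieldOn [IsManifold I ∞ N] (A : ∀ x : N, TangentSpace I x) (u : Set N) : Prop :=
  ContMDiffOn I I.tangent ∞ (fun x => (⟨x, A x⟩ : TangentBundle I N)) u

/-- Complex vector fields, i.e. sections of the complexified tangent bundle (no regularity). -/
abbrev CField (N : Type*) [TopologicalSpace N] [ChartedSpace H N] :=
  ∀ x : N, ComplexVec (TangentSpace I x)

variable {I}

/-- The complex vector field `Z = A + i B` is smooth on the set `u`. -/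
def CField.SmoothOn [IsManifold I ∞ N] (Z : CField I N) (u : Set N) : Prop :=
  SmoothFieldOn I (fun x => (Z x).re) u ∧ SmoothFieldOn I (fun x => (Z x).im) u

/-- The complex-bilinear extension of the Lie bracket of vector fields:
`[A + iB, C + iD] = ([A, C] - [B, D]) + i ([A, D] + [B, C])`. -/
noncomputable def CField.bracket (Z W : CField I N) : CField I N := fun x =>
  ⟨VectorField.mlieBracket I (fun y => (Z y).re) (fun y => (W y).re) x
      - VectorField.mlieBracket I (fun y => (Z y).im) (fun y => (W y).im) x,
    VectorField.mlieBracket I (fun y => (Z y).re) (fun y => (W y).im) x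
      + VectorField.mlieBracket I (fun y => (Z y).im) (fun y => (W y).re) x⟩

end VectorFields

/-! ### CR structures -/

section CR

variable {E H N : Type*} [NormedAddCommGroup E] [NormedSpace ℝ E] [TopologicalSpace H]
  {I : ModelWithCorners ℝ E H} [TopologicalSpace N] [ChartedSpace H N]

/-- The `-i` eigenspace, in the complexification `ℂ ⊗ P` of a subspace `P` of a real vector space
`T`, of the complexification of an endomorphism `J` of `P`: `a + i b` (with `a, b ∈ P`) lies in it
iff `J a + i J b = -i (a + i b)`. When `J² = -1` this is the set of all `a + i J a`, `a ∈ P`. -/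
def antiHolomorphic {T : Type*} [AddCommGroup T] [Module ℝ T] (P : Submodule ℝ T)
    (J : P →ₗ[ℝ] P) : Submodule ℂ (ComplexVec T) where
  carrier := {Z | ∃ a b : P, Z = ⟨a, b⟩ ∧ J a = b ∧ J b = -a}
  zero_mem' := ⟨0, 0, rfl, by simp, by simp⟩
  add_mem' := by
    rintro _ _ ⟨a, b, rfl, h1, h2⟩ ⟨a', b', rfl, h1', h2'⟩
    refine ⟨a + a', b + b', rfl, by simp [h1, h1'], ?_⟩
    rw [map_add, h2, h2', neg_add]
  smul_mem' := by
    rintro c _ ⟨a, b, rfl, h1, h2⟩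
    refine ⟨c.re • a - c.im • b, c.re • b + c.im • a, rfl, ?_, ?_⟩
    · rw [map_sub, map_smul, map_smul, h1, h2]; module
    · rw [map_add, map_smul, map_smul, h1, h2]; module

/-- An (integrable) CR structure of type `(n, k)` on the open subset `Ω` of the manifold `N`,
which makes `Ω` a CR manifold of type `(n, k)`. A CR structure on all of `N` is the case
`Ω = univ`. The values of `D` and `J` at points outside `Ω` carry no information. -/
structure CRStructure (I : ModelWithCorners ℝ E H) [IsManifold I ∞ N]
    (Ω : Set N) (n k : ℕ) where
  isOpen : IsOpen Ω
  dim_eq : Module.finrank ℝ E = 2 * n + k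
  /-- the distribution -/
  D : ∀ x : N, Submodule ℝ (TangentSpace I x)
  /-- the field of endomorphisms of the distribution -/
  J : ∀ x : N, D x →ₗ[ℝ] D x
  J_sq : ∀ x ∈ Ω, ∀ v : D x, J x (J x v) = -v
  /-- `D` is a smooth distribution of rank `2 n` and `J` is smooth: near every point, `D` has a
  smooth frame `e` whose image under `J` is smooth. -/
  exists_frame : ∀ x ∈ Ω, ∃ u ⊆ Ω, IsOpen u ∧ x ∈ u ∧
    ∃ e : Fin (2 * n) → ∀ y : N, D y,
      (∀ i, SmoothFieldOn I (fun y => (e i y : TangentSpace I y)) u) ∧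
      (∀ i, SmoothFieldOn I (fun y => (J y (e i y) : TangentSpace I y)) u) ∧
      ∀ y ∈ u, LinearIndependent ℝ (fun i => e i y) ∧
        Submodule.span ℝ (range fun i => e i y) = ⊤
  /-- `D^{0,1}` is involutive. -/
  involutive : ∀ u ⊆ Ω, IsOpen u → ∀ Z W : CField I N, Z.SmoothOn u → W.SmoothOn u →
    (∀ y ∈ u, Z y ∈ antiHolomorphic (D y) (J y)) →
    (∀ y ∈ u, W y ∈ antiHolomorphic (D y) (J y)) →
    ∀ y ∈ u, Z.bracket W y ∈ antiHolomorphic (D y) (J y)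

namespace CRStructure

variable [IsManifold I ∞ N] {Ω : Set N} {n k : ℕ}

/-- The fibre at `x` of `D^{0,1}`, the `-i` eigendistribution of `J`. -/
noncomputable def D01 (S : CRStructure I Ω n k) (x : N) : Submodule ℂ (ComplexVec (TangentSpace I x)) :=
  antiHolomorphic (S.D x) (S.J x)

/-- The fibre at `x` of the complexification of `D`. -/
noncomputable def DC (S : CRStructure I Ω n k) (x : N) : Submodule ℂ (ComplexVec (TangentSpace I x)) where
  carrier := {Z | Z.re ∈ S.D x ∧ Z.im ∈ S.D x}
  zero_mem' := ⟨zero_mem _, zero_mem _⟩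
  add_mem' h h' := ⟨add_mem h.1 h'.1, add_mem h.2 h'.2⟩
  smul_mem' _ _ h :=
    ⟨sub_mem (Submodule.smul_mem _ _ h.1) (Submodule.smul_mem _ _ h.2),
      add_mem (Submodule.smul_mem _ _ h.2) (Submodule.smul_mem _ _ h.1)⟩

/-- The smooth complex vector field `X` normalises the sections of `D^{0,1}`:
`[X, Z]` is a section of `D^{0,1}` for every (local) smooth section `Z` of `D^{0,1}`. -/
def Normalises (S : CRStructure I Ω n k) (X : CField I N) : Prop :=
  ∀ u ⊆ Ω, IsOpen u → ∀ Z : CField I N, Z.SmoothOn u → (∀ y ∈ u, Z y ∈ S.D01 y) →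
    ∀ y ∈ u, X.bracket Z y ∈ S.D01 y

/-- The restriction of a CR structure to a smaller open set. -/
noncomputable def restrict (S : CRStructure I Ω n k) (U : Set N) (hU : IsOpen U) (hUΩ : U ⊆ Ω) :
    CRStructure I U n k where
  isOpen := hU
  dim_eq := S.dim_eq
  D := S.D
  J := S.J
  J_sq x hx := S.J_sq x (hUΩ hx)
  exists_frame x hx := by
    obtain ⟨u, _, huo, hxu, e, he, hJe, hb⟩ := S.exists_frame x (hUΩ hx)
    exact ⟨u ∩ U, inter_subset_right, huo.inter hU, ⟨hxu, hx⟩, e,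
      fun i => (he i).mono inter_subset_left, fun i => (hJe i).mono inter_subset_left,
      fun y hy => hb y hy.1⟩
  involutive u hu := S.involutive u (hu.trans hUΩ)

end CRStructure

/-- `F` restricts to a CR embedding of the CR manifold `(Ω, S)` into the CR manifold `(Ω', S')`:
a smooth embedding (smooth, immersive, homeomorphic onto its image) whose differential maps `D`
into `D'` and intertwines `J` and `J'`. -/
structure IsCREmbedding {E' H' N' : Type*} [NormedAddCommGroup E'] [NormedSpace ℝ E']
    [TopologicalSpace H'] {I' : ModelWithCorners ℝ E' H'} [TopologicalSpace N']
    [ChartedSpace H' N'] [IsManifold I ∞ N] [IsManifold I' ∞ N']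
    {Ω : Set N} {Ω' : Set N'} {n k n' k' : ℕ}
    (S : CRStructure I Ω n k) (S' : CRStructure I' Ω' n' k') (F : N → N') : Prop where
  mapsTo : MapsTo F Ω Ω'
  smooth : ContMDiffOn I I' ∞ F Ω
  isEmbedding : Topology.IsEmbedding (Ω.domRestrict F)
  immersion : ∀ x ∈ Ω, Function.Injective (mfderiv I I' F x)
  map_J : ∀ x ∈ Ω, ∀ v : S.D x, ∃ h : mfderiv I I' F x (v : TangentSpace I x) ∈ S'.D (F x),
    (S'.J (F x) ⟨_, h⟩ : TangentSpace I' (F x)) =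
      mfderiv I I' F x (S.J x v : TangentSpace I x)

end CR

/-! ### The coefficients coming from the Maurer-Cartan form -/

/-- For structure constants `[ξ_μ, ξ_ν] = ∑ γ, c μ ν γ • ξ_γ` (so `c μ ν γ` is `c_{μν}^γ`), the
matrix of `ad v : w ↦ [v, w]` in the basis `ξ`, for the vector `v = ∑ μ, v μ • ξ_μ`. -/
def adMatrix {s : ℕ} (c : Fin s → Fin s → Fin s → ℂ) (v : Fin s → ℂ) :
    Matrix (Fin s) (Fin s) ℂ :=
  Matrix.of fun γ ν => ∑ μ, v μ * c μ ν γ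

/-- The `dτ^α` component of the left-invariant Maurer-Cartan form `g⁻¹ dg` in the exponential
coordinates of the second kind `g = ⋯ exp (τ^2 η_2) exp (τ^1 η_1)`, namely
`Ad (exp (-τ^1 η_1)) ⋯ Ad (exp (-τ^{α-1} η_{α-1})) η_α`, as a vector of coefficients in the basis
`ξ`; here `Ad (exp v) = exp (ad v)`. Factors of `g` further to the left do not change it. -/
noncomputable def maurerCartanCoeff {s ℓ : ℕ} (c : Fin s → Fin s → Fin s → ℂ)
    (η : Fin ℓ → Fin s → ℂ) (τ : Fin ℓ → ℂ) (α : Fin ℓ) : Fin s → ℂ :=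
  (List.ofFn fun j : Fin α =>
      NormedSpace.exp (-(τ (j.castLE α.isLt.le)) • adMatrix c (η (j.castLE α.isLt.le)))).prod
    *ᵥ η α

/-! ### The product with a Euclidean factor -/

section Product

variable {E M : Type*} [NormedAddCommGroup E] [NormedSpace ℝ E] [TopologicalSpace M]
  [ChartedSpace E M] {ℓ : ℕ}

/-- The model with corners of `M × ℝ^ℓ`. -/
noncomputable abbrev prodModel (E : Type*) [NormedAddCommGroup E] [NormedSpace ℝ E] (ℓ : ℕ) :
    ModelWithCorners ℝ (E × EuclideanSpace ℝ (Fin ℓ)) (ModelProd E (EuclideanSpace ℝ (Fin ℓ))) :=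
  𝓘(ℝ, E).prod 𝓘(ℝ, EuclideanSpace ℝ (Fin ℓ))

/-- The inclusion of the complexified tangent space of `M` at `q` as the horizontal vectors in the
complexified tangent space `ℂ ⊗ (T_q M × ℝ^ℓ)` of `M × ℝ^ℓ` at `(q, t)`. -/
noncomputable def horizontal (q : M) (t : EuclideanSpace ℝ (Fin ℓ)) :
    ComplexVec (TangentSpace 𝓘(ℝ, E) q) →ₗ[ℂ]
      ComplexVec (TangentSpace (prodModel E ℓ) (q, t)) :=
  ComplexVec.map (V := E) (W := E × EuclideanSpace ℝ (Fin ℓ))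
    (LinearMap.inl ℝ E (EuclideanSpace ℝ (Fin ℓ)))

/-- The coordinate vector field `∂_α = ∂/∂t^α` of `M × ℝ^ℓ`. -/
noncomputable def coordField (α : Fin ℓ) : CField (prodModel E ℓ) (M × EuclideanSpace ℝ (Fin ℓ)) := fun _ =>
  ⟨((0, EuclideanSpace.single α 1) : E × EuclideanSpace ℝ (Fin ℓ)),
    ((0, 0) : E × EuclideanSpace ℝ (Fin ℓ))⟩

/-- The vector field `Y_α = ∑ γ, λ_α^γ(t) X_γ + i ∂_α` on `M × ℝ^ℓ`, where
`λ_α(t) = ω_α(-i t)` for the Maurer-Cartan coefficients `ω_α` of `η`. -/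
noncomputable def Yfield {s : ℕ} (c : Fin s → Fin s → Fin s → ℂ) (η : Fin ℓ → Fin s → ℂ)
    (X : Fin s → CField 𝓘(ℝ, E) M) (α : Fin ℓ) :
    CField (prodModel E ℓ) (M × EuclideanSpace ℝ (Fin ℓ)) := fun z =>
  horizontal z.1 z.2
      (∑ γ, maurerCartanCoeff c η (fun j => -Complex.I * (z.2 j : ℂ)) α γ • X γ z.1)
    + Complex.I • coordField α z

end Product

/-!
The fields `Y_α` are built so that they commute with each other modulo `D^{0,1}`. Since the `X_γ`
normalise the sections of `D^{0,1}`, so do the combinations `∑ γ, v^γ X_γ` with constant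
coefficients; modulo sections of `D^{0,1}` these combinations form a Lie algebra with structure
constants `c`. The `c` themselves need not satisfy the Jacobi identity, because the `X_γ` may be
dependent: it holds modulo the space `K` of those `v` for which `∑ γ, v^γ X_γ` is a section of
`D^{0,1}`, and `K` is an ideal (`isJacobiIdeal_sectionCoeffs`). Hence `exp (ad u)` is an
automorphism modulo `K`, and differentiating the product of exponentials that defines `ω_β` gives
`ad (ω_α) ω_β + ∂ω_β/∂τ^α ∈ K` for `α < β`, which is the Maurer–Cartan equation in coordinates of
the second kind (`IsJacobiIdeal.maurerCartan`); for `α ≥ β` the derivative vanishes. With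
`τ = -i t`, so that `i ∂/∂t^α = ∂/∂τ^α`, the left-hand side is the vector of coefficients of
`[Y_α, Y_β]` up to `D^{0,1}` (`bracket_Yfield_Yfield_mem`).

It follows that the spaces `extendedD01`, spanned by `D^{0,1}` and the `Y_α`, are closed under
brackets. They form the `(0,1)`-distribution of a CR structure wherever they have rank `n + ℓ` and
contain no nonzero purely imaginary vector. Both conditions say that the real parts of a frame over
`ℝ` (the lifts of a frame `e_j + i J e_j` of `D^{0,1}`, the `Y_α` and the `-i Y_α`) are linearly
independent. Those of the `-i Y_α` have independent `∂/∂t`-components, so what has to be arranged is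
that the `e_j` and the real parts of the `ε_α X_{σ(α)}` are independent at `p`; this then persists
nearby. Transversality at `p` makes the `X_γ` span a space of dimension `ℓ` modulo `ℂ ⊗ D_p`. A
basis of it consists of certain `X_{σ(α)}`, and these can be replaced, one at a time, by their own
real part or that of `i X_{σ(α)}` without losing independence (`exists_selection`). The endomorphism
`J` is recovered from the distribution as the map `Re z ↦ Im z` (`exists_endomorphism`,
`exists_crStructure_of_frames`).
-/

/-! ### Calculus of complex vector fields -/

section ComplexCalculus

variable {E H N : Type*} [NormedAddCommGroup E] [NormedSpace ℝ E] [TopologicalSpace H]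
  {I : ModelWithCorners ℝ E H} [TopologicalSpace N] [ChartedSpace H N]

open VectorField

/-- The real and imaginary parts of the complex vector field `Z` are differentiable at `x`. -/
def CField.DiffAt [IsManifold I ∞ N] (Z : CField I N) (x : N) : Prop :=
  MDiffAt (fun y => (⟨y, (Z y).re⟩ : TangentBundle I N)) x ∧
    MDiffAt (fun y => (⟨y, (Z y).im⟩ : TangentBundle I N)) x

/-- The derivative of a complex-valued function along a complex tangent vector. -/
noncomputable def cderiv (f : N → ℂ) (x : N) (v : ComplexVec (TangentSpace I x)) : ℂ :=
  mvfderiv I f x v.re + Complex.I * mvfderiv I f x v.im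

namespace CField

theorem bracket_swap (Z W : CField I N) (x : N) : Z.bracket W x = -W.bracket Z x := by
  ext
  · simp only [bracket, ComplexVec.neg_re]
    rw [mlieBracket_swap_apply, mlieBracket_swap_apply (V := fun y => (Z y).im)]
    abel
  · simp only [bracket, ComplexVec.neg_im]
    rw [mlieBracket_swap_apply, mlieBracket_swap_apply (V := fun y => (Z y).im)]
    abel

theorem bracket_self (Z : CField I N) (x : N) : Z.bracket Z x = 0 := by
  ext
  · simp [bracket]
  · simp only [bracket, ComplexVec.zero_im]
    rw [mlieBracket_swap_apply]
    abel

theorem bracket_congr {Z Z' W W' : CField I N} {x : N} (hZ : ∀ᶠ y in 𝓝 x, Z y = Z' y)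
    (hW : ∀ᶠ y in 𝓝 x, W y = W' y) : Z.bracket W x = Z'.bracket W' x := by
  have h1 : (fun y => (Z y).re) =ᶠ[𝓝 x] fun y => (Z' y).re := hZ.mono fun y hy => by
    simp only []; rw [hy]
  have h2 : (fun y => (Z y).im) =ᶠ[𝓝 x] fun y => (Z' y).im := hZ.mono fun y hy => by
    simp only []; rw [hy]
  have h3 : (fun y => (W y).re) =ᶠ[𝓝 x] fun y => (W' y).re := hW.mono fun y hy => by
    simp only []; rw [hy]
  have h4 : (fun y => (W y).im) =ᶠ[𝓝 x] fun y => (W' y).im := hW.mono fun y hy => by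
    simp only []; rw [hy]
  simp only [bracket, h1.mlieBracket_vectorField_eq h3, h1.mlieBracket_vectorField_eq h4,
    h2.mlieBracket_vectorField_eq h3, h2.mlieBracket_vectorField_eq h4]

section

variable [IsManifold I ∞ N] {Z W W' : CField I N} {x : N}

theorem SmoothOn.diffAt {u : Set N} (hZ : Z.SmoothOn u) (hu : IsOpen u) (hx : x ∈ u) :
    Z.DiffAt x :=
  ⟨(hZ.1.contMDiffAt (hu.mem_nhds hx)).mdifferentiableAt (by simp),
    (hZ.2.contMDiffAt (hu.mem_nhds hx)).mdifferentiableAt (by simp)⟩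

theorem DiffAt.add (hZ : Z.DiffAt x) (hW : W.DiffAt x) : (Z + W).DiffAt x :=
  ⟨mdifferentiableAt_add_section hZ.1 hW.1, mdifferentiableAt_add_section hZ.2 hW.2⟩

theorem diffAt_zero : (0 : CField I N).DiffAt x :=
  ⟨Bundle.mdifferentiableAt_zeroSection .., Bundle.mdifferentiableAt_zeroSection ..⟩

theorem DiffAt.sum {ι : Type*} {s : Finset ι} {Z : ι → CField I N} (hZ : ∀ i ∈ s, (Z i).DiffAt x) :
    (∑ i ∈ s, Z i).DiffAt x := by
  classical
  induction s using Finset.induction_on with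
  | empty => exact diffAt_zero
  | insert a s ha ih =>
    rw [Finset.sum_insert ha]
    exact (hZ a (by simp)).add (ih fun i hi => hZ i (by simp [hi]))

omit [IsManifold I ∞ N] in
theorem mdifferentiableAt_re {f : N → ℂ} (hf : MDifferentiableAt I 𝓘(ℝ, ℂ) f x) :
    MDifferentiableAt I 𝓘(ℝ, ℝ) (fun y => (f y).re) x :=
  Complex.reCLM.mdifferentiableAt.comp x hf

omit [IsManifold I ∞ N] in
theorem mdifferentiableAt_im {f : N → ℂ} (hf : MDifferentiableAt I 𝓘(ℝ, ℂ) f x) :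
    MDifferentiableAt I 𝓘(ℝ, ℝ) (fun y => (f y).im) x :=
  Complex.imCLM.mdifferentiableAt.comp x hf

omit [IsManifold I ∞ N] in
theorem mvfderiv_clm_comp {F G : Type*} [NormedAddCommGroup F] [NormedSpace ℝ F]
    [NormedAddCommGroup G] [NormedSpace ℝ G] (L : F →L[ℝ] G) {f : N → F}
    (hf : MDifferentiableAt I 𝓘(ℝ, F) f x) (v : TangentSpace I x) :
    mvfderiv I (fun y => L (f y)) x v = L (mvfderiv I f x v) := by
  have h := mfderiv_comp (I := I) (I' := 𝓘(ℝ, F)) (I'' := 𝓘(ℝ, G)) x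
    (g := L) (f := f) L.mdifferentiableAt hf
  have h' : mfderiv I 𝓘(ℝ, G) (fun y => L (f y)) x = _ := h
  simp only [mvfderiv, h', ContinuousLinearMap.comp_apply]
  rw [L.mfderiv_eq]
  rfl

theorem DiffAt.smul {f : N → ℂ} (hf : MDifferentiableAt I 𝓘(ℝ, ℂ) f x) (hZ : Z.DiffAt x) :
    CField.DiffAt (fun y => f y • Z y) x :=
  ⟨mdifferentiableAt_sub_section ((mdifferentiableAt_re hf).smul_section hZ.1)
      ((mdifferentiableAt_im hf).smul_section hZ.2),
    mdifferentiableAt_add_section ((mdifferentiableAt_re hf).smul_section hZ.2)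
      ((mdifferentiableAt_im hf).smul_section hZ.1)⟩

theorem DiffAt.const_smul (c : ℂ) (hZ : Z.DiffAt x) : (c • Z).DiffAt x :=
  DiffAt.smul (f := fun _ => c) mdifferentiableAt_const hZ

theorem SmoothOn.add {u : Set N} (hZ : Z.SmoothOn u) (hW : W.SmoothOn u) : (Z + W).SmoothOn u :=
  ⟨hZ.1.add_section hW.1, hZ.2.add_section hW.2⟩

theorem smoothOn_zero {u : Set N} : (0 : CField I N).SmoothOn u :=
  ⟨(Bundle.contMDiff_zeroSection ℝ (TangentSpace I : N → Type _)).contMDiffOn,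
    (Bundle.contMDiff_zeroSection ℝ (TangentSpace I : N → Type _)).contMDiffOn⟩

theorem SmoothOn.sum {u : Set N} {ι : Type*} {s : Finset ι} {Z : ι → CField I N}
    (hZ : ∀ i ∈ s, (Z i).SmoothOn u) : (∑ i ∈ s, Z i).SmoothOn u := by
  classical
  induction s using Finset.induction_on with
  | empty => exact smoothOn_zero
  | insert a s ha ih =>
    rw [Finset.sum_insert ha]
    exact (hZ a (by simp)).add (ih fun i hi => hZ i (by simp [hi]))

theorem SmoothOn.smul {u : Set N} {f : N → ℂ} (hf : ContMDiffOn I 𝓘(ℝ, ℂ) ∞ f u)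
    (hZ : Z.SmoothOn u) : CField.SmoothOn (fun y => f y • Z y) u := by
  have hr : ContMDiffOn I 𝓘(ℝ, ℝ) ∞ (fun y => (f y).re) u :=
    Complex.reCLM.contMDiff.comp_contMDiffOn hf
  have hi : ContMDiffOn I 𝓘(ℝ, ℝ) ∞ (fun y => (f y).im) u :=
    Complex.imCLM.contMDiff.comp_contMDiffOn hf
  exact ⟨(hr.smul_section hZ.1).sub_section (hi.smul_section hZ.2),
    (hr.smul_section hZ.2).add_section (hi.smul_section hZ.1)⟩

theorem SmoothOn.const_smul {u : Set N} (c : ℂ) (hZ : Z.SmoothOn u) : (c • Z).SmoothOn u :=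
  SmoothOn.smul (f := fun _ => c) contMDiffOn_const hZ

variable [CompleteSpace E]

theorem bracket_add_right (hW : W.DiffAt x) (hW' : W'.DiffAt x) :
    Z.bracket (W + W') x = Z.bracket W x + Z.bracket W' x := by
  have e1 : (fun y => ((W + W') y).re) = (fun y => (W y).re) + fun y => (W' y).re := rfl
  have e2 : (fun y => ((W + W') y).im) = (fun y => (W y).im) + fun y => (W' y).im := rfl
  ext
  · simp only [bracket, ComplexVec.add_re, e1, e2]
    rw [mlieBracket_add_right hW.1 hW'.1, mlieBracket_add_right hW.2 hW'.2]
    abel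
  · simp only [bracket, ComplexVec.add_im, e1, e2]
    rw [mlieBracket_add_right hW.1 hW'.1, mlieBracket_add_right hW.2 hW'.2]
    abel

omit [IsManifold I ∞ N] [CompleteSpace E] in
theorem bracket_zero_right : Z.bracket 0 x = 0 := by
  have e (V : ∀ y : N, TangentSpace I y) : mlieBracket I V (fun _ => 0) x = 0 :=
    congrFun (mlieBracket_zero_right (W := V)) x
  ext <;> simp [bracket, e]

theorem bracket_sum_right {ι : Type*} {s : Finset ι} {W : ι → CField I N}
    (hW : ∀ i ∈ s, (W i).DiffAt x) :
    Z.bracket (∑ i ∈ s, W i) x = ∑ i ∈ s, Z.bracket (W i) x := by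
  classical
  induction s using Finset.induction_on with
  | empty => exact bracket_zero_right
  | insert a s ha ih =>
    rw [Finset.sum_insert ha, Finset.sum_insert ha, bracket_add_right (hW a (by simp))
      (DiffAt.sum fun i hi => hW i (by simp [hi])), ih fun i hi => hW i (by simp [hi])]

/-- The Leibniz rule `[Z, f W] = Z(f) W + f [Z, W]` for a complex-valued function `f`. -/
theorem bracket_smul_right {f : N → ℂ} (hf : MDifferentiableAt I 𝓘(ℝ, ℂ) f x) (hW : W.DiffAt x) :
    Z.bracket (fun y => f y • W y) x = cderiv f x (Z x) • W x + f x • Z.bracket W x := by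
  have hr := mdifferentiableAt_re hf
  have hi := mdifferentiableAt_im hf
  have e1 : (fun y => (f y • W y).re) = (fun y => (f y).re) • (fun y => (W y).re)
      + (-fun y => (f y).im) • fun y => (W y).im := by
    funext y; simp [sub_eq_add_neg]
  have e2 : (fun y => (f y • W y).im) = (fun y => (f y).re) • (fun y => (W y).im)
      + (fun y => (f y).im) • fun y => (W y).re := rfl
  have d1 (v : TangentSpace I x) : mvfderiv I (fun y => (f y).re) x v = (mvfderiv I f x v).re :=
    mvfderiv_clm_comp Complex.reCLM hf v
  have d2 (v : TangentSpace I x) : mvfderiv I (fun y => (f y).im) x v = (mvfderiv I f x v).im :=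
    mvfderiv_clm_comp Complex.imCLM hf v
  have d3 (v : TangentSpace I x) :
      mvfderiv I (-fun y => (f y).im) x v = -(mvfderiv I f x v).im :=
    mvfderiv_clm_comp (-Complex.imCLM) hf v
  ext
  · simp only [bracket, e1, e2]
    rw [mlieBracket_add_right (hr.smul_section hW.1) (hi.neg.smul_section hW.2),
      mlieBracket_add_right (hr.smul_section hW.2) (hi.smul_section hW.1),
      mlieBracket_smul_right hr hW.1, mlieBracket_smul_right hi.neg hW.2,
      mlieBracket_smul_right hr hW.2, mlieBracket_smul_right hi hW.1]
    simp only [d1, d2, d3, cderiv, ComplexVec.add_re, ComplexVec.smul_re]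
    simp
    module
  · simp only [bracket, e1, e2]
    rw [mlieBracket_add_right (hr.smul_section hW.1) (hi.neg.smul_section hW.2),
      mlieBracket_add_right (hr.smul_section hW.2) (hi.smul_section hW.1),
      mlieBracket_smul_right hr hW.1, mlieBracket_smul_right hi.neg hW.2,
      mlieBracket_smul_right hr hW.2, mlieBracket_smul_right hi hW.1]
    simp only [d1, d2, d3, cderiv, ComplexVec.add_im, ComplexVec.smul_im]
    simp
    module

theorem bracket_const_smul_right (c : ℂ) (hW : W.DiffAt x) :
    Z.bracket (c • W) x = c • Z.bracket W x := by
  have h := bracket_smul_right (Z := Z) (f := fun _ => c) (x := x) mdifferentiableAt_const hW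
  have h0 : cderiv (I := I) (fun _ => c) x (Z x) = 0 := by
    simp [cderiv, mvfderiv_const]
  rw [h0, zero_smul, zero_add] at h
  exact h

theorem bracket_add_left (hW : W.DiffAt x) (hW' : W'.DiffAt x) :
    (W + W').bracket Z x = W.bracket Z x + W'.bracket Z x := by
  rw [bracket_swap, bracket_add_right hW hW', bracket_swap Z W, bracket_swap Z W']
  abel

theorem bracket_sum_left {ι : Type*} {s : Finset ι} {W : ι → CField I N}
    (hW : ∀ i ∈ s, (W i).DiffAt x) :
    (∑ i ∈ s, W i).bracket Z x = ∑ i ∈ s, (W i).bracket Z x := by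
  rw [bracket_swap, bracket_sum_right hW, ← Finset.sum_neg_distrib]
  exact Finset.sum_congr rfl fun i _ => (bracket_swap _ _ _).symm

theorem bracket_smul_left {f : N → ℂ} (hf : MDifferentiableAt I 𝓘(ℝ, ℂ) f x) (hW : W.DiffAt x) :
    CField.bracket (fun y => f y • W y) Z x =
      f x • W.bracket Z x - cderiv f x (Z x) • W x := by
  rw [bracket_swap, bracket_smul_right hf hW, bracket_swap Z W]
  module

theorem bracket_const_smul_left (c : ℂ) (hW : W.DiffAt x) :
    (c • W).bracket Z x = c • W.bracket Z x := by
  rw [bracket_swap, bracket_const_smul_right c hW, bracket_swap Z W, smul_neg, neg_neg]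

theorem SmoothOn.bracket {u : Set N} (hu : IsOpen u) (hZ : Z.SmoothOn u) (hW : W.SmoothOn u) :
    (Z.bracket W).SmoothOn u := by
  have : IsManifold I (∞ + 1) N := inferInstanceAs (IsManifold I ∞ N)
  have : IsManifold I (minSmoothness ℝ 2) N := by
    simp only [minSmoothness_of_isRCLikeNormedField]; infer_instance
  have key {A B : ∀ y : N, TangentSpace I y} (hA : SmoothFieldOn I A u)
      (hB : SmoothFieldOn I B u) : SmoothFieldOn I (mlieBracket I A B) u := fun y hy =>
    (ContMDiffAt.mlieBracket_vectorField (m := ⊤) (n := ⊤)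
      (hA.contMDiffAt (hu.mem_nhds hy)) (hB.contMDiffAt (hu.mem_nhds hy))
      (by simp)).contMDiffWithinAt
  exact ⟨(key hZ.1 hW.1).sub_section (key hZ.2 hW.2), (key hZ.1 hW.2).add_section (key hZ.2 hW.1)⟩

/-- The Jacobi identity, in Leibniz form, for complex vector fields. -/
theorem bracket_bracket {A B C : CField I N} (hA : A.SmoothOn univ) (hB : B.SmoothOn univ)
    (hC : C.SmoothOn univ) (x : N) :
    A.bracket (B.bracket C) x = (A.bracket B).bracket C x + B.bracket (A.bracket C) x := by
  have : IsManifold I (∞ + 1) N := inferInstanceAs (IsManifold I ∞ N)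
  have : IsManifold I (minSmoothness ℝ 2) N := by
    simp only [minSmoothness_of_isRCLikeNormedField]; infer_instance
  have h2' : (2 : ℕ∞ω) ≤ ∞ := ENat.LEInfty.out
  have jac {U V W : ∀ y : N, TangentSpace I y} (hU : SmoothFieldOn I U univ)
      (hV : SmoothFieldOn I V univ) (hW : SmoothFieldOn I W univ) :
      mlieBracket I U (mlieBracket I V W) x =
        mlieBracket I (mlieBracket I U V) W x + mlieBracket I V (mlieBracket I U W) x := by
    have : IsManifold I (minSmoothness ℝ 3) N := by
      simp only [minSmoothness_of_isRCLikeNormedField]; infer_instance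
    have h2 {A : ∀ y : N, TangentSpace I y} (hA : SmoothFieldOn I A univ) :
        ContMDiffAt I I.tangent (minSmoothness ℝ 2) (fun y => (⟨y, A y⟩ : TangentBundle I N)) x :=
      (hA.contMDiffAt Filter.univ_mem).of_le (by simpa using h2')
    exact leibniz_identity_mlieBracket_apply (h2 hU) (h2 hV) (h2 hW)
  have dif {U V : ∀ y : N, TangentSpace I y} (hU : SmoothFieldOn I U univ)
      (hV : SmoothFieldOn I V univ) :
      MDiffAt (fun y => (⟨y, mlieBracket I U V y⟩ : TangentBundle I N)) x :=
    (ContMDiffAt.mlieBracket_vectorField (m := 1) (n := ⊤)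
      (hU.contMDiffAt Filter.univ_mem) (hV.contMDiffAt Filter.univ_mem)
      (by simpa [one_add_one_eq_two] using h2')).mdifferentiableAt (by simp)
  have difn {U V : ∀ y : N, TangentSpace I y} (hU : SmoothFieldOn I U univ)
      (hV : SmoothFieldOn I V univ) :
      MDiffAt (fun y => (⟨y, ((-1 : ℝ) • mlieBracket I U V) y⟩ : TangentBundle I N)) x :=
    (dif hU hV).smul_const_section
  have er (Z W : CField I N) : (fun y => (Z.bracket W y).re) =
      mlieBracket I (fun y => (Z y).re) (fun y => (W y).re)
        + (-1 : ℝ) • mlieBracket I (fun y => (Z y).im) (fun y => (W y).im) := by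
    funext y; simp [CField.bracket, sub_eq_add_neg]
  have ei (Z W : CField I N) : (fun y => (Z.bracket W y).im) =
      mlieBracket I (fun y => (Z y).re) (fun y => (W y).im)
        + mlieBracket I (fun y => (Z y).im) (fun y => (W y).re) := rfl
  obtain ⟨a, a'⟩ := hA
  obtain ⟨b, b'⟩ := hB
  obtain ⟨c, c'⟩ := hC
  have e (Z W : CField I N) : Z.bracket W x =
      ⟨mlieBracket I (fun y => (Z y).re) (fun y => (W y).re) x
      - mlieBracket I (fun y => (Z y).im) (fun y => (W y).im) x,
      mlieBracket I (fun y => (Z y).re) (fun y => (W y).im) x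
        + mlieBracket I (fun y => (Z y).im) (fun y => (W y).re) x⟩ := rfl
  rw [e A, e _ C, e B]
  simp only [er, ei]
  -- expand into real brackets, and apply the real Jacobi identity to each of the eight triples
  rw [mlieBracket_add_right (dif b c) (difn b' c'), mlieBracket_add_right (dif b c') (dif b' c),
    mlieBracket_add_right (dif b c) (difn b' c'), mlieBracket_add_right (dif b c') (dif b' c),
    mlieBracket_add_right (dif a c) (difn a' c'), mlieBracket_add_right (dif a c') (dif a' c),
    mlieBracket_add_right (dif a c) (difn a' c'), mlieBracket_add_right (dif a c') (dif a' c),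
    mlieBracket_add_left (dif a b) (difn a' b'), mlieBracket_add_left (dif a b') (dif a' b),
    mlieBracket_add_left (dif a b) (difn a' b'), mlieBracket_add_left (dif a b') (dif a' b)]
  simp only [mlieBracket_const_smul_right (dif b' c'), mlieBracket_const_smul_right (dif a' c'),
    mlieBracket_const_smul_left (dif a' b')]
  rw [jac a b c, jac a b' c', jac a' b c', jac a' b' c, jac a b c', jac a b' c, jac a' b c,
    jac a' b' c']
  ext
  · simp only [ComplexVec.add_re]
    module
  · simp only [ComplexVec.add_im]
    module

end

end CField
end ComplexCalculus

/-! ### Lie brackets on a product with a vector space -/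

section ProductFields

variable {E F M : Type*} [NormedAddCommGroup E] [NormedSpace ℝ E] [NormedAddCommGroup F]
  [NormedSpace ℝ F] [TopologicalSpace M] [ChartedSpace E M]

open VectorField

/-- The vector field `(q, t) ↦ (A q, v)` on `M × F`, where the second component is constant. -/
def prodConstField (A : ∀ q : M, TangentSpace 𝓘(ℝ, E) q) (v : F) (z : M × F) :
    TangentSpace (𝓘(ℝ, E).prod 𝓘(ℝ, F)) z :=
  ((A z.1, v) : E × F)

theorem lieBracket_prod_const [CompleteSpace E] {a b : E → E} {v w : F} {z : E} {t : F}
    (ha : DifferentiableAt ℝ a z) (hb : DifferentiableAt ℝ b z) :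
    lieBracket ℝ (fun y : E × F => (a y.1, v)) (fun y : E × F => (b y.1, w)) (z, t) =
      (lieBracket ℝ a b z, 0) := by
  have key {a : E → E} {v : F} (ha : DifferentiableAt ℝ a z) :
      fderiv ℝ (fun y : E × F => (a y.1, v)) (z, t) =
        ((fderiv ℝ a z).comp (ContinuousLinearMap.fst ℝ E F)).prod 0 := by
    have h : HasFDerivAt (fun y : E × F => a y.1)
        ((fderiv ℝ a z).comp (ContinuousLinearMap.fst ℝ E F)) (z, t) :=
      HasFDerivAt.comp (g := a) (z, t) ha.hasFDerivAt (ContinuousLinearMap.fst ℝ E F).hasFDerivAt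
    exact (h.prodMk (hasFDerivAt_const v _)).fderiv
  simp [lieBracket, key ha, key hb]

variable [IsManifold 𝓘(ℝ, E) ∞ M]

theorem ContinuousLinearMap.inverse_prodMap_id {D : E →L[ℝ] E} (hD : D.IsInvertible)
    (x : E × F) :
    (D.prodMap (ContinuousLinearMap.id ℝ F)).inverse x = (D.inverse x.1, x.2) := by
  obtain ⟨e, rfl⟩ := hD
  have h : ContinuousLinearMap.prodMap (e : E →L[ℝ] E) (ContinuousLinearMap.id ℝ F) =
    ((ContinuousLinearEquiv.prodCongr e (ContinuousLinearEquiv.refl ℝ F) :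
      (E × F) ≃L[ℝ] E × F) : E × F →L[ℝ] E × F) := rfl
  rw [h, ContinuousLinearMap.inverse_equiv, ContinuousLinearMap.inverse_equiv]
  rfl

omit [IsManifold 𝓘(ℝ, E) ∞ M] in
/-- On a manifold without boundary, the Lie bracket at `x` is the Lie bracket of the coordinate
expressions in the preferred chart at `x`, whose derivative at `x` is the identity. -/
theorem mlieBracket_eq_lieBracket {E H N : Type*} [NormedAddCommGroup E] [NormedSpace ℝ E]
    [TopologicalSpace H] {I : ModelWithCorners ℝ E H} [TopologicalSpace N] [ChartedSpace H N]
    [IsManifold I ∞ N] (hI : range I = univ) (V W : ∀ x : N, TangentSpace I x) (x : N) :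
    mlieBracket I V W x =
      lieBracket ℝ (mpullbackWithin 𝓘(ℝ, E) I (extChartAt I x).symm V (range I))
        (mpullbackWithin 𝓘(ℝ, E) I (extChartAt I x).symm W (range I)) (extChartAt I x x) := by
  have key (L : E →L[ℝ] E) (hL : L = ContinuousLinearMap.id ℝ E) (v : E) : L.inverse v = v := by
    rw [hL, ContinuousLinearMap.inverse_id]; rfl
  rw [mlieBracket, mlieBracketWithin_apply]
  refine (key _ mfderiv_extChartAt_self _).trans ?_
  have hs : (extChartAt I x).symm ⁻¹' univ ∩ range I = univ := by rw [hI]; simp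
  rw [hs]
  exact congrFun lieBracketWithin_univ _

theorem mfderivWithin_extChartAt_prod_symm (q : M) (t : F) {z : E} (s : F)
    (hz : z ∈ (extChartAt 𝓘(ℝ, E) q).target) :
    mfderivWithin 𝓘(ℝ, E × F) (𝓘(ℝ, E).prod 𝓘(ℝ, F))
      (extChartAt (𝓘(ℝ, E).prod 𝓘(ℝ, F)) (q, t)).symm
      (range (𝓘(ℝ, E).prod 𝓘(ℝ, F))) (z, s) =
    (ContinuousLinearMap.prodMap (mfderivWithin 𝓘(ℝ, E) 𝓘(ℝ, E) (extChartAt 𝓘(ℝ, E) q).symm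
      (range 𝓘(ℝ, E)) z) (ContinuousLinearMap.id ℝ F) : E × F →L[ℝ] E × F) := by
  have hr : range (𝓘(ℝ, E).prod 𝓘(ℝ, F)) = univ := by
    rw [modelWithCorners_prod_coe, range_prodMap]; simp
  have hf : HasMFDerivWithinAt 𝓘(ℝ, E) 𝓘(ℝ, E) (extChartAt 𝓘(ℝ, E) q).symm univ z
      (mfderivWithin 𝓘(ℝ, E) 𝓘(ℝ, E) (extChartAt 𝓘(ℝ, E) q).symm (range 𝓘(ℝ, E)) z) := by
    have := (mdifferentiableWithinAt_extChartAt_symm (I := 𝓘(ℝ, E)) hz).hasMFDerivWithinAt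
    simpa using this
  have h1 : HasMFDerivWithinAt 𝓘(ℝ, E × F) 𝓘(ℝ, E)
      (fun y : E × F => (extChartAt 𝓘(ℝ, E) q).symm y.1) univ (z, s) _ :=
    HasMFDerivWithinAt.comp (f := Prod.fst) (g := (extChartAt 𝓘(ℝ, E) q).symm)
        (z, s) hf (ContinuousLinearMap.fst ℝ E F).hasMFDerivAt.hasMFDerivWithinAt (subset_univ _)
  have h2 : HasMFDerivWithinAt 𝓘(ℝ, E × F) 𝓘(ℝ, F) (fun y : E × F => y.2)
      univ (z, s) _ := (ContinuousLinearMap.snd ℝ E F).hasMFDerivAt.hasMFDerivWithinAt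
  have hp := h1.prodMk h2
  rw [hr]
  have he : (extChartAt (𝓘(ℝ, E).prod 𝓘(ℝ, F)) (q, t)).symm =
      ((extChartAt 𝓘(ℝ, E) q).symm.prod (PartialEquiv.refl F)) := by
    have h3 : extChartAt 𝓘(ℝ, F) t = PartialEquiv.refl F := extChartAt_model_space_eq_id ℝ t
    rw [extChartAt_prod, PartialEquiv.prod_symm, h3]
    rfl
  rw [he]
  have hc : ((extChartAt 𝓘(ℝ, E) q).symm.prod (PartialEquiv.refl F) : E × F → M × F) =
      fun y => ((extChartAt 𝓘(ℝ, E) q).symm y.1, y.2) := rfl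
  rw [hc]
  exact hp.mfderivWithin (uniqueMDiffWithinAt_univ _)

/-- In the preferred chart of the product, the coordinate expression of `(A, v)` is the coordinate
expression of `A` together with the constant `v`. -/
theorem mpullbackWithin_prodConstField [CompleteSpace E]
    (A : ∀ q : M, TangentSpace 𝓘(ℝ, E) q) (v : F) (q : M) (t : F) {z : E} (s : F)
    (hz : z ∈ (extChartAt 𝓘(ℝ, E) q).target) :
    mpullbackWithin 𝓘(ℝ, E × F) (𝓘(ℝ, E).prod 𝓘(ℝ, F))
      (extChartAt (𝓘(ℝ, E).prod 𝓘(ℝ, F)) (q, t)).symm (prodConstField A v)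
      (range (𝓘(ℝ, E).prod 𝓘(ℝ, F))) (z, s) =
    ((mpullbackWithin 𝓘(ℝ, E) 𝓘(ℝ, E) (extChartAt 𝓘(ℝ, E) q).symm A (range 𝓘(ℝ, E)) z, v) :
      E × F) := by
  rw [mpullbackWithin_apply, mfderivWithin_extChartAt_prod_symm q t s hz, mpullbackWithin_apply]
  exact ContinuousLinearMap.inverse_prodMap_id (E := E)
    (D := mfderivWithin 𝓘(ℝ, E) 𝓘(ℝ, E) (extChartAt 𝓘(ℝ, E) q).symm (range 𝓘(ℝ, E)) z)
    (isInvertible_mfderivWithin_extChartAt_symm (I := 𝓘(ℝ, E)) hz) _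

theorem mlieBracket_prodConstField [CompleteSpace E]
    {A B : ∀ q : M, TangentSpace 𝓘(ℝ, E) q} {v w : F} {q : M} {t : F}
    (hA : MDiffAt (fun y => (⟨y, A y⟩ : TangentBundle 𝓘(ℝ, E) M)) q)
    (hB : MDiffAt (fun y => (⟨y, B y⟩ : TangentBundle 𝓘(ℝ, E) M)) q) :
    mlieBracket (𝓘(ℝ, E).prod 𝓘(ℝ, F)) (prodConstField A v) (prodConstField B w) (q, t) =
      prodConstField (mlieBracket 𝓘(ℝ, E) A B) 0 (q, t) := by
  have hr : range (𝓘(ℝ, E).prod 𝓘(ℝ, F)) = univ := by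
    rw [modelWithCorners_prod_coe, range_prodMap]; simp
  have h0 : extChartAt (𝓘(ℝ, E).prod 𝓘(ℝ, F)) (q, t) (q, t) = (extChartAt 𝓘(ℝ, E) q q, t) := by
    have h3 : extChartAt 𝓘(ℝ, F) t = PartialEquiv.refl F := extChartAt_model_space_eq_id ℝ t
    rw [extChartAt_prod, h3]
    rfl
  have hnear : ∀ᶠ y : E × F in 𝓝 (extChartAt 𝓘(ℝ, E) q q, t),
      y.1 ∈ (extChartAt 𝓘(ℝ, E) q).target :=
    continuous_fst.continuousAt.eventually (extChartAt_target_mem_nhds (I := 𝓘(ℝ, E)) q)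
  have hd {A : ∀ q : M, TangentSpace 𝓘(ℝ, E) q}
      (hA : MDiffAt (fun y => (⟨y, A y⟩ : TangentBundle 𝓘(ℝ, E) M)) q) :
      DifferentiableAt ℝ (mpullbackWithin 𝓘(ℝ, E) 𝓘(ℝ, E) (extChartAt 𝓘(ℝ, E) q).symm A
        (range 𝓘(ℝ, E)) : E → E) (extChartAt 𝓘(ℝ, E) q q) := by
    have := MDifferentiableWithinAt.differentiableWithinAt_mpullbackWithin_vectorField
      (mdifferentiableWithinAt_univ.2 hA)
    rw [preimage_univ, univ_inter] at this
    exact this.differentiableAt (by simp)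
  have e1 (A : ∀ q : M, TangentSpace 𝓘(ℝ, E) q) (v : F) := hnear.mono fun y hy =>
    mpullbackWithin_prodConstField A v q t y.2 hy
  rw [mlieBracket_eq_lieBracket hr, h0]
  refine (Filter.EventuallyEq.lieBracket_vectorField_eq (e1 A v) (e1 B w)).trans ?_
  refine (lieBracket_prod_const (v := v) (w := w) (hd hA) (hd hB)).trans ?_
  rw [prodConstField, mlieBracket_eq_lieBracket (by simp)]

theorem smoothFieldOn_prodConstField {A : ∀ q : M, TangentSpace 𝓘(ℝ, E) q} {u : Set M}
    (hA : SmoothFieldOn 𝓘(ℝ, E) A u) (v : F) :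
    SmoothFieldOn (𝓘(ℝ, E).prod 𝓘(ℝ, F)) (prodConstField A v) (Prod.fst ⁻¹' u) := by
  have h1 : ContMDiffOn (𝓘(ℝ, E).prod 𝓘(ℝ, F)) (𝓘(ℝ, E).tangent.prod 𝓘(ℝ, F).tangent) ∞
      (fun z : M × F => ((⟨z.1, A z.1⟩, ⟨z.2, v⟩) :
        TangentBundle 𝓘(ℝ, E) M × TangentBundle 𝓘(ℝ, F) F)) (Prod.fst ⁻¹' u) := by
    refine ContMDiffOn.prodMk (ContMDiffOn.comp hA contMDiff_fst.contMDiffOn fun x hx => hx) ?_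
    have : ContMDiff 𝓘(ℝ, F) 𝓘(ℝ, F).tangent ∞ (fun t : F => (⟨t, v⟩ : TangentBundle 𝓘(ℝ, F) F)) :=
      contMDiff_vectorSpace_iff_contDiff.2 contDiff_const
    exact (this.comp contMDiff_snd).contMDiffOn
  exact (contMDiff_equivTangentBundleProd_symm (I := 𝓘(ℝ, E)) (I' := 𝓘(ℝ, F)) (M := M)
    (M' := F)).comp_contMDiffOn h1

end ProductFields

/-! ### Real and complex linear algebra -/

section LinearAlgebra

namespace ComplexVec

variable {V W : Type*} [AddCommGroup V] [Module ℝ V] [AddCommGroup W] [Module ℝ W]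

@[simp] theorem map_re (f : V →ₗ[ℝ] W) (z : ComplexVec V) : (map f z).re = f z.re := rfl
@[simp] theorem map_im (f : V →ₗ[ℝ] W) (z : ComplexVec V) : (map f z).im = f z.im := rfl

theorem real_smul_eq (r : ℝ) (z : ComplexVec V) : r • z = ⟨r • z.re, r • z.im⟩ := by
  change (r : ℂ) • z = _
  ext
  · rw [smul_re, Complex.ofReal_re, Complex.ofReal_im, zero_smul, sub_zero]
  · rw [smul_im, Complex.ofReal_re, Complex.ofReal_im, zero_smul, add_zero]

/-- The real part, as a real-linear map. -/
def reₗ : ComplexVec V →ₗ[ℝ] V where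
  toFun z := z.re
  map_add' _ _ := rfl
  map_smul' r z := by rw [real_smul_eq]; rfl

@[simp] theorem reₗ_apply (z : ComplexVec V) : reₗ z = z.re := rfl

/-- The imaginary part, as a real-linear map. -/
def imₗ : ComplexVec V →ₗ[ℝ] V where
  toFun z := z.im
  map_add' _ _ := rfl
  map_smul' r z := by rw [real_smul_eq]; rfl

@[simp] theorem imₗ_apply (z : ComplexVec V) : imₗ z = z.im := rfl

theorem re_sum_smul {ι : Type*} [Fintype ι] (b : ι → ℝ) (Z : ι → ComplexVec V) :
    (∑ i, b i • Z i).re = ∑ i, b i • (Z i).re := by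
  rw [← reₗ_apply, map_sum]
  simp only [map_smul, reₗ_apply]

/-- The underlying real vector space of `ComplexVec V` is `V × V`. -/
def equivProd : ComplexVec V ≃ₗ[ℝ] V × V where
  toFun z := (z.re, z.im)
  invFun w := ⟨w.1, w.2⟩
  map_add' _ _ := rfl
  map_smul' r z := by rw [real_smul_eq]; rfl
  left_inv _ := rfl
  right_inv _ := rfl

instance [FiniteDimensional ℝ V] : FiniteDimensional ℂ (ComplexVec V) :=
  have : FiniteDimensional ℝ (ComplexVec V) := equivProd.symm.finiteDimensional
  FiniteDimensional.right ℝ ℂ _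

/-- The real-linear inclusion of `V` into its complexification. -/
def ofReal : V →ₗ[ℝ] ComplexVec V where
  toFun v := ⟨v, 0⟩
  map_add' _ _ := by ext <;> simp
  map_smul' r z := by rw [real_smul_eq]; simp

@[simp] theorem ofReal_re (v : V) : (ofReal v).re = v := rfl
@[simp] theorem ofReal_im (v : V) : (ofReal v).im = 0 := rfl

/-- From complex vectors that are linearly independent over `ℂ`, real vectors that are linearly
independent over `ℝ` arise by choosing for each of them its real or its imaginary part (up to
sign). -/
theorem exists_linearIndependent_re {ι : Type*} [Fintype ι] {x : ι → ComplexVec W}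
    (hx : LinearIndependent ℂ x) :
    ∃ ε : ι → ℂ, (∀ j, ε j = 1 ∨ ε j = Complex.I) ∧
      LinearIndependent ℝ fun j => (ε j • x j).re := by
  classical
  have upd {y : ι → ComplexVec W} (hy : LinearIndependent ℂ y) (j : ι) (m : ComplexVec W)
      (hm : m ∉ Submodule.span ℂ (y '' {j}ᶜ)) : LinearIndependent ℂ (Function.update y j m) := by
    have hc : EqOn (Function.update y j m) y {j}ᶜ := fun i hi => Function.update_of_ne hi _ _
    rw [← linearIndepOn_univ_iff, ← insert_eq_of_mem (mem_univ j), ← union_compl_self {j},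
      singleton_union, insert_idem, linearIndepOn_insert_iff, hc.image_eq]
    exact ⟨(linearIndepOn_congr hc).2 ((linearIndepOn_univ_iff.2 hy).mono (subset_univ _)),
      fun h => (hm (by simpa using h)).elim⟩
  -- the vectors are replaced by real ones one at a time
  have key (s : Finset ι) : ∃ ε : ι → ℂ, (∀ j, ε j = 1 ∨ ε j = Complex.I) ∧
      LinearIndependent ℂ fun j => if j ∈ s then ofReal (ε j • x j).re else x j := by
    induction s using Finset.induction_on with
    | empty => exact ⟨fun _ => 1, fun _ => .inl rfl, by simpa using hx⟩
    | insert j s hj ih =>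
      obtain ⟨ε, hε, hli⟩ := ih
      set y : ι → ComplexVec W := fun i => if i ∈ s then ofReal (ε i • x i).re else x i with hy
      have hyj : y j = x j := by simp [hy, hj]
      obtain ⟨e, he, hm⟩ : ∃ e : ℂ, (e = 1 ∨ e = Complex.I) ∧
          ofReal (e • x j).re ∉ Submodule.span ℂ (y '' {j}ᶜ) := by
        by_contra! hcon
        have h1 := hcon 1 (.inl rfl)
        have h2 := hcon Complex.I (.inr rfl)
        refine hli.notMem_span_image (s := {j}ᶜ) (x := j) (by simp) ?_
        have : y j = ofReal ((1 : ℂ) • x j).re - Complex.I • ofReal (Complex.I • x j).re := by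
          rw [hyj, sub_eq_add_neg]
          ext <;> simp
        rw [this]
        exact sub_mem h1 (Submodule.smul_mem _ _ h2)
      refine ⟨Function.update ε j e, fun i => ?_, ?_⟩
      · rcases eq_or_ne i j with rfl | h
        · simpa using he
        · simpa [h] using hε i
      · convert upd hli j _ hm using 1
        funext i
        rcases eq_or_ne i j with rfl | h
        · simp
        · simp [hy, h]
  obtain ⟨ε, hε, hli⟩ := key Finset.univ
  refine ⟨ε, hε, ?_⟩
  have h : LinearIndependent ℝ fun j => ofReal (ε j • x j).re := by
    simpa using hli.restrict_scalars' ℝ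
  exact LinearIndependent.of_comp ofReal h

end ComplexVec

open ComplexVec

variable {T : Type*} [AddCommGroup T] [Module ℝ T]

/-- The real parts of the vectors of a complex subspace of the complexification of `T`. -/
noncomputable def rePart (L : Submodule ℂ (ComplexVec T)) : Submodule ℝ T :=
  (L.restrictScalars ℝ).map reₗ

theorem mem_rePart {L : Submodule ℂ (ComplexVec T)} {a : T} :
    a ∈ rePart L ↔ ∃ z ∈ L, z.re = a := Iff.rfl

theorem im_mem_rePart {L : Submodule ℂ (ComplexVec T)} {z : ComplexVec T} (hz : z ∈ L) :
    z.im ∈ rePart L :=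
  ⟨(-Complex.I) • z, L.smul_mem _ hz, by simp⟩

/-- A complex subspace `L` of the complexification of `T` without nonzero purely imaginary vectors
is the `-i` eigenspace of an endomorphism of the space of its real parts. -/
theorem exists_endomorphism (L : Submodule ℂ (ComplexVec T)) :
    ∃ J : rePart L →ₗ[ℝ] rePart L, (∀ z ∈ L, z.re = 0 → z = 0) →
      (∀ v, J (J v) = -v) ∧ antiHolomorphic (rePart L) J = L := by
  by_cases hL : ∀ z ∈ L, z.re = 0 → z = 0
  swap
  · exact ⟨0, fun h => (hL h).elim⟩
  have hinj : ∀ z ∈ L, ∀ w ∈ L, z.re = w.re → z = w := fun z hz w hw h =>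
    sub_eq_zero.1 (hL _ (sub_mem hz hw) (by simp [sub_eq_add_neg, h]))
  choose! f hf hfre using fun a (ha : a ∈ rePart L) => mem_rePart.1 ha
  let J : rePart L →ₗ[ℝ] rePart L :=
    { toFun := fun v => ⟨(f v).im, im_mem_rePart (hf v v.2)⟩
      map_add' := fun v w => by
        have := hinj _ (hf _ (v + w).2) _ (add_mem (hf _ v.2) (hf _ w.2)) (by
          rw [hfre _ (v + w).2, add_re, hfre _ v.2, hfre _ w.2]; rfl)
        ext; simp only [this]; rfl
      map_smul' := fun r v => by
        have := hinj _ (hf _ (r • v).2) _ (L.smul_mem (r : ℂ) (hf _ v.2)) (by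
          rw [hfre _ (r • v).2, smul_re, hfre _ v.2]; simp)
        ext
        simp only [this, smul_im, Complex.ofReal_re, Complex.ofReal_im, zero_smul, add_zero]
        rfl }
  have hJ (z : ComplexVec T) (hz : z ∈ L) : J ⟨z.re, z, hz, rfl⟩ = ⟨z.im, im_mem_rePart hz⟩ := by
    have := hinj _ (hf z.re ⟨z, hz, rfl⟩) z hz (hfre z.re ⟨z, hz, rfl⟩)
    ext; simp only [J, LinearMap.coe_mk, AddHom.coe_mk, this]
  have hJ2 (z : ComplexVec T) (hz : z ∈ L) :
      J ⟨z.im, im_mem_rePart hz⟩ = -⟨z.re, z, hz, rfl⟩ := by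
    have := hJ _ (L.smul_mem (-Complex.I) hz)
    ext
    have h := congrArg Subtype.val this
    simp only [smul_re, smul_im] at h
    simpa using h
  refine ⟨J, fun _ => ⟨?_, ?_⟩⟩
  · rintro ⟨_, z, hz, rfl⟩
    exact (congrArg J (hJ z hz)).trans (hJ2 z hz)
  · ext z
    constructor
    · rintro ⟨⟨_, w, hw, rfl⟩, b, rfl, h1, -⟩
      have := (hJ w hw).symm.trans h1
      rw [← this]
      exact hw
    · intro hz
      exact ⟨⟨z.re, z, hz, rfl⟩, ⟨z.im, im_mem_rePart hz⟩, rfl, hJ z hz, hJ2 z hz⟩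

/-- The complexified projection `ℂ ⊗ T → ℂ ⊗ (T / P)` has the complexification of `P` as its
kernel. -/
theorem map_mkQ_eq_zero_iff {P : Submodule ℝ T} {z : ComplexVec T} :
    ComplexVec.map P.mkQ z = 0 ↔ z.re ∈ P ∧ z.im ∈ P := by
  rw [ComplexVec.ext_iff]
  simp

/-- Vectors in a product are independent as soon as the ones without second component are
independent in the first factor, and the others are lifts of a basis of the second factor. -/
theorem linearIndependent_prod_lift {F ι κ : Type*} [AddCommGroup F] [Module ℝ F] {a : ι → T}
    (ha : LinearIndependent ℝ a) (b : κ → T) {d : κ → F} (hd : LinearIndependent ℝ d) :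
    LinearIndependent ℝ (Sum.elim (fun i => ((a i, 0) : T × F)) fun j => (b j, d j)) := by
  refine LinearIndependent.sum_type (ha.map' (LinearMap.inl ℝ T F)
    (LinearMap.ker_eq_bot_of_injective LinearMap.inl_injective))
    (LinearIndependent.of_comp (LinearMap.snd ℝ T F) hd) ?_
  rw [Submodule.disjoint_def]
  intro x hx hx'
  have h1 : x.2 = 0 := by
    have : Submodule.span ℝ (range fun i => ((a i, 0) : T × F)) ≤
        LinearMap.ker (LinearMap.snd ℝ T F) :=
      Submodule.span_le.2 (by rintro _ ⟨i, rfl⟩; simp)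
    exact this hx
  rw [Finsupp.mem_span_range_iff_exists_finsupp] at hx'
  obtain ⟨c, rfl⟩ := hx'
  have h2 : c = 0 := by
    refine linearIndependent_iff.1 hd c ?_
    rw [Finsupp.linearCombination_apply, ← h1, Finsupp.sum, Finsupp.sum, Prod.snd_sum]
    simp
  simp [h2]

/-- The space of antiholomorphic vectors is isomorphic to `P` over `ℝ` by the real part. -/
theorem finrank_antiHolomorphic {P : Submodule ℝ T} {J : P →ₗ[ℝ] P} (hJ : ∀ v, J (J v) = -v)
    {n : ℕ} (hP : Module.finrank ℝ P = 2 * n) :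
    Module.finrank ℂ (antiHolomorphic P J) = n := by
  let e : P →ₗ[ℝ] antiHolomorphic P J :=
    { toFun := fun v => ⟨⟨v, J v⟩, v, J v, rfl, rfl, hJ v⟩
      map_add' := fun v w => by ext <;> simp
      map_smul' := fun r v => by
        refine Subtype.ext ?_
        change _ = r • (⟨v, J v⟩ : ComplexVec T)
        rw [real_smul_eq]
        simp }
  have he : Function.Bijective e := by
    constructor
    · intro v w h
      exact Subtype.ext (congrArg (fun z : antiHolomorphic P J => z.1.re) h)
    · rintro ⟨_, a, b, rfl, h1, h2⟩
      exact ⟨a, by subst h1; rfl⟩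
  have h := (LinearEquiv.ofBijective e he).finrank_eq
  rw [hP, finrank_real_of_complex] at h
  omega

/-- The algebraic heart of the choice of `σ` and `ε`: vectors spanning an extension of `L` of rank
`ℓ` that is transverse to `ℂ ⊗ D` contain `ℓ` members which, after multiplication by `1` or `i`,
have real parts that are linearly independent modulo `D`. -/
theorem exists_selection [FiniteDimensional ℝ T] {D : Submodule ℝ T}
    {L : Submodule ℂ (ComplexVec T)} {s ℓ n : ℕ} (X : Fin s → ComplexVec T)
    (hLD : ∀ z ∈ L, z.re ∈ D ∧ z.im ∈ D) (hL : Module.finrank ℂ L = n)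
    (hrank : Module.finrank ℂ ↥(L ⊔ Submodule.span ℂ (range X)) = n + ℓ)
    (htrans : ∀ z ∈ L ⊔ Submodule.span ℂ (range X), z.re ∈ D → z.im ∈ D → z ∈ L) :
    ∃ (σ : Fin ℓ → Fin s) (ε : Fin ℓ → ℂ), Function.Injective σ ∧
      (∀ α, ε α = 1 ∨ ε α = Complex.I) ∧
      LinearIndependent ℝ fun α => D.mkQ (ε α • X (σ α)).re := by
  set K := L ⊔ Submodule.span ℂ (range X) with hK
  let g : ComplexVec T →ₗ[ℂ] ComplexVec (T ⧸ D) := ComplexVec.map D.mkQ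
  have hker : LinearMap.ker (g.domRestrict K) = L.comap K.subtype := by
    ext ⟨z, hz⟩
    change g z = 0 ↔ z ∈ L
    rw [map_mkQ_eq_zero_iff]
    exact ⟨fun h => htrans z hz h.1 h.2, hLD z⟩
  have hmap : LinearMap.range (g.domRestrict K) = Submodule.span ℂ (range (g ∘ X)) := by
    rw [LinearMap.range_domRestrict, hK, Submodule.map_sup, Submodule.map_span, range_comp,
      sup_eq_right]
    rintro _ ⟨z, hz, rfl⟩
    rw [(map_mkQ_eq_zero_iff (P := D)).2 (hLD z hz)]
    exact zero_mem _
  have hfin := LinearMap.finrank_range_add_finrank_ker (g.domRestrict K)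
  rw [hker, hmap, hrank, (Submodule.comapSubtypeEquivOfLe (le_sup_left : L ≤ K)).finrank_eq, hL]
    at hfin
  obtain ⟨κ, a, ha, hspan, hli⟩ := exists_linearIndependent' ℂ (g ∘ X)
  have : Finite κ := Finite.of_injective a ha
  have : Fintype κ := Fintype.ofFinite κ
  have hcard : Fintype.card κ = ℓ := by
    rw [← finrank_span_eq_card hli, hspan]; omega
  let e : Fin ℓ ≃ κ := (Fintype.equivFinOfCardEq hcard).symm
  obtain ⟨ε, hε, h⟩ := exists_linearIndependent_re (hli.comp e e.injective)
  refine ⟨a ∘ e, ε, ha.comp e.injective, hε, ?_⟩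
  have hre : (fun α => D.mkQ (ε α • X ((a ∘ e) α)).re) =
      fun j => (ε j • (((g ∘ X) ∘ a) ∘ e) j).re := by
    funext α
    simp [g]
  rw [hre]
  exact h

end LinearAlgebra

/-! ### Left translations by exponentials and the Maurer–Cartan equation -/

section MaurerCartan

open scoped Matrix.Norms.Operator

variable {s : ℕ}

theorem adMatrix_mulVec_apply (c : Fin s → Fin s → Fin s → ℂ) (v w : Fin s → ℂ) (γ : Fin s) :
    (adMatrix c v *ᵥ w) γ = ∑ ν, ∑ μ, v μ * w ν * c μ ν γ := by
  simp only [Matrix.mulVec, dotProduct, adMatrix, Matrix.of_apply, Finset.sum_mul]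
  exact Finset.sum_congr rfl fun _ _ => Finset.sum_congr rfl fun _ _ => by ring

theorem adMatrix_add (c : Fin s → Fin s → Fin s → ℂ) (v w : Fin s → ℂ) :
    adMatrix c (v + w) = adMatrix c v + adMatrix c w := by
  ext γ ν
  simp [adMatrix, add_mul, Finset.sum_add_distrib]

theorem adMatrix_smul (c : Fin s → Fin s → Fin s → ℂ) (a : ℂ) (v : Fin s → ℂ) :
    adMatrix c (a • v) = a • adMatrix c v := by
  ext γ ν
  simp [adMatrix, Finset.mul_sum, mul_assoc]

/-- The bracket `(v, w) ↦ ad v w` as a linear map in `v`. -/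
def adLinear (c : Fin s → Fin s → Fin s → ℂ) :
    (Fin s → ℂ) →ₗ[ℂ] Matrix (Fin s) (Fin s) ℂ where
  toFun := adMatrix c
  map_add' := adMatrix_add c
  map_smul' := adMatrix_smul c

theorem HasDerivAt.matrix_mulVec {A : ℝ → Matrix (Fin s) (Fin s) ℂ} {v : ℝ → Fin s → ℂ}
    {A' : Matrix (Fin s) (Fin s) ℂ} {v' : Fin s → ℂ} {x : ℝ} (hA : HasDerivAt A A' x)
    (hv : HasDerivAt v v' x) :
    HasDerivAt (fun y => A y *ᵥ v y) (A' *ᵥ v x + A x *ᵥ v') x := by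
  have h1 (j : Fin s) : HasDerivAt (fun y => (A y)ᵀ j) (A'ᵀ j) x := by
    let L : Matrix (Fin s) (Fin s) ℂ →ₗ[ℝ] (Fin s → ℂ) :=
      { toFun := fun A => Aᵀ j, map_add' := fun _ _ => rfl, map_smul' := fun _ _ => rfl }
    exact L.toContinuousLinearMap.hasFDerivAt.comp_hasDerivAt x hA
  have h2 : HasDerivAt (fun y => ∑ j, v y j • (A y)ᵀ j)
      (∑ j, (v x j • A'ᵀ j + v' j • (A x)ᵀ j)) x :=
    HasDerivAt.fun_sum fun j _ => (hasDerivAt_pi.1 hv j).smul (h1 j)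
  have e (B : Matrix (Fin s) (Fin s) ℂ) (w : Fin s → ℂ) : B *ᵥ w = ∑ j, w j • Bᵀ j := by
    ext i
    simp [Matrix.mulVec, dotProduct, mul_comm]
  simpa only [e, ← Finset.sum_add_distrib] using h2

/-- A curve that starts in a subspace, and whose velocity stays in it, stays in it. -/
theorem mem_of_hasDerivAt_mem {F : Type*} [NormedAddCommGroup F] [NormedSpace ℂ F]
    [FiniteDimensional ℂ F] {K : Submodule ℂ F} {G G' : ℝ → F}
    (hG : ∀ t, HasDerivAt G (G' t) t) (hG' : ∀ t, G' t ∈ K) (h0 : G 0 ∈ K) (t : ℝ) : G t ∈ K := by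
  by_contra hcon
  obtain ⟨f, hf, hK⟩ := Submodule.exists_dual_map_eq_bot_of_notMem hcon inferInstance
  have hfK : ∀ v ∈ K, f v = 0 := fun v hv => by
    have : f v ∈ K.map f := ⟨v, hv, rfl⟩
    simpa [hK] using this
  let L : F →L[ℝ] ℂ := (LinearMap.toContinuousLinearMap f).restrictScalars ℝ
  have hd (t : ℝ) : HasDerivAt (fun t => L (G t)) 0 t := by
    have := L.hasFDerivAt.comp_hasDerivAt t (hG t)
    rwa [show L (G' t) = 0 from hfK _ (hG' t)] at this
  have hconst := is_const_of_deriv_eq_zero (fun t => (hd t).differentiableAt)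
    (fun t => (hd t).deriv) t 0
  exact hf (hconst.trans (hfK _ h0))

theorem exp_mulVec_mem {K : Submodule ℂ (Fin s → ℂ)} {A : Matrix (Fin s) (Fin s) ℂ}
    (hA : ∀ v ∈ K, A *ᵥ v ∈ K) {v : Fin s → ℂ} (hv : v ∈ K) : NormedSpace.exp A *ᵥ v ∈ K := by
  let L : Matrix (Fin s) (Fin s) ℂ →ₗ[ℂ] (Fin s → ℂ) :=
    { toFun := fun B => B *ᵥ v
      map_add' := fun B B' => Matrix.add_mulVec B B' v
      map_smul' := fun r B => Matrix.smul_mulVec r B v }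
  have h := L.toContinuousLinearMap.hasSum (NormedSpace.exp_series_hasSum_exp' (𝕂 := ℂ) A)
  refine (Submodule.closed_of_finiteDimensional K).mem_of_tendsto h (.of_forall fun S => ?_)
  refine K.sum_mem fun n hn => ?_
  clear hn
  change ((n.factorial : ℂ)⁻¹ • A ^ n) *ᵥ v ∈ K
  rw [Matrix.smul_mulVec]
  refine K.smul_mem _ ?_
  induction n with
  | zero => simpa using hv
  | succ n ih =>
    rw [pow_succ', ← Matrix.mulVec_mulVec]
    exact hA _ ih

variable {c : Fin s → Fin s → Fin s → ℂ} {K : Submodule ℂ (Fin s → ℂ)}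

/-- `K` is a left ideal for the product with structure constants `c`, modulo which the Jacobi
identity holds. -/
structure IsJacobiIdeal (c : Fin s → Fin s → Fin s → ℂ) (K : Submodule ℂ (Fin s → ℂ)) : Prop where
  ideal : ∀ u, ∀ v ∈ K, adMatrix c u *ᵥ v ∈ K
  jacobi : ∀ u v w, adMatrix c u *ᵥ (adMatrix c v *ᵥ w) -
    (adMatrix c (adMatrix c u *ᵥ v) *ᵥ w + adMatrix c v *ᵥ (adMatrix c u *ᵥ w)) ∈ K

/-- The matrix `A` preserves `K` and induces an endomorphism of the algebra modulo `K`. -/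
structure IsHomMod (c : Fin s → Fin s → Fin s → ℂ) (K : Submodule ℂ (Fin s → ℂ))
    (A : Matrix (Fin s) (Fin s) ℂ) : Prop where
  mem : ∀ v ∈ K, A *ᵥ v ∈ K
  hom : ∀ v w, A *ᵥ (adMatrix c v *ᵥ w) - adMatrix c (A *ᵥ v) *ᵥ (A *ᵥ w) ∈ K

theorem IsHomMod.one : IsHomMod c K 1 where
  mem v hv := by simpa using hv
  hom v w := by simp

theorem IsHomMod.mul {A B : Matrix (Fin s) (Fin s) ℂ} (hA : IsHomMod c K A)
    (hB : IsHomMod c K B) : IsHomMod c K (A * B) where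
  mem v hv := by
    rw [← Matrix.mulVec_mulVec]
    exact hA.mem _ (hB.mem _ hv)
  hom v w := by
    simp only [← Matrix.mulVec_mulVec]
    have h := add_mem (hA.mem _ (hB.hom v w)) (hA.hom (B *ᵥ v) (B *ᵥ w))
    rwa [Matrix.mulVec_sub, sub_add_sub_cancel] at h

/-- The exponential of a derivation is an automorphism: modulo `K`, `ad u` is a derivation. -/
theorem IsJacobiIdeal.isHomMod_exp (hK : IsJacobiIdeal c K) (u : Fin s → ℂ) :
    IsHomMod c K (NormedSpace.exp (adMatrix c u)) where
  mem v hv := exp_mulVec_mem (hK.ideal u) hv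
  hom v w := by
    set D := adMatrix c u with hD
    let e (t : ℝ) : Matrix (Fin s) (Fin s) ℂ := NormedSpace.exp (t • D)
    have he (t : ℝ) : HasDerivAt e (D * e t) t := hasDerivAt_exp_smul_const' D t
    have he' (t : ℝ) : HasDerivAt (fun t => e (-t)) (-(e (-t) * D)) t := by
      have := (hasDerivAt_exp_smul_const D (-t)).scomp t (hasDerivAt_neg t)
      rw [neg_one_smul] at this
      exact this
    have hev (t : ℝ) (v : Fin s → ℂ) : HasDerivAt (fun t => e t *ᵥ v) (D *ᵥ (e t *ᵥ v)) t := by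
      simpa using (he t).matrix_mulVec (hasDerivAt_const t v)
    have hb (t : ℝ) : HasDerivAt (fun t => adMatrix c (e t *ᵥ v) *ᵥ (e t *ᵥ w))
        (adMatrix c (D *ᵥ (e t *ᵥ v)) *ᵥ (e t *ᵥ w)
          + adMatrix c (e t *ᵥ v) *ᵥ (D *ᵥ (e t *ᵥ w))) t := by
      have h1 : HasDerivAt (fun t => adMatrix c (e t *ᵥ v)) (adMatrix c (D *ᵥ (e t *ᵥ v))) t :=
        ((adLinear c).restrictScalars ℝ).toContinuousLinearMap.hasFDerivAt.comp_hasDerivAt t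
          (hev t v)
      exact h1.matrix_mulVec (hev t w)
    have hKe (t : ℝ) {z : Fin s → ℂ} (hz : z ∈ K) : e t *ᵥ z ∈ K :=
      exp_mulVec_mem (fun v hv => by
        rw [Matrix.smul_mulVec]
        exact K.smul_mem (t : ℂ) (hK.ideal u v hv)) hz
    have hG (t : ℝ) := (he' t).matrix_mulVec (hb t)
    -- the curve `t ↦ e^{-tD} [e^{tD} v, e^{tD} w] - [v, w]` vanishes at `0`, with velocity in `K`
    have hmem := mem_of_hasDerivAt_mem (K := K)
      (fun t => (hG t).sub (hasDerivAt_const t (adMatrix c v *ᵥ w))) (fun t => ?_) ?_ 1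
    · have h1 := hKe 1 hmem
      have h2 : e 1 * e (-1) = 1 := by
        simp only [e, one_smul, neg_smul]
        exact (NormedSpace.exp_add_of_commute (Commute.neg_right (Commute.refl D))).symm.trans
          (by rw [add_neg_cancel, NormedSpace.exp_zero])
      rw [Pi.sub_apply, Matrix.mulVec_sub, Matrix.mulVec_mulVec, h2, Matrix.one_mulVec] at h1
      have h3 := neg_mem h1
      simpa [e] using h3
    · have h1 := hKe (-t) (neg_mem (hK.jacobi u (e t *ᵥ v) (e t *ᵥ w)))
      rw [sub_zero]
      convert h1 using 1
      rw [neg_sub, Matrix.mulVec_sub, Matrix.neg_mulVec, ← Matrix.mulVec_mulVec, neg_add_eq_sub]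
    · simp [e]

/-- The product `exp (t^1 ad ζ_1) ⋯ exp (t^m ad ζ_m)` with real times. -/
noncomputable def expProd (c : Fin s → Fin s → Fin s → ℂ) {m : ℕ} (ζ : Fin m → Fin s → ℂ)
    (t : Fin m → ℝ) : Matrix (Fin s) (Fin s) ℂ :=
  (List.ofFn fun j => NormedSpace.exp (t j • adMatrix c (ζ j))).prod

theorem expProd_succ {m : ℕ} (ζ : Fin (m + 1) → Fin s → ℂ) (t : Fin (m + 1) → ℝ) :
    expProd c ζ t = expProd c (fun j => ζ j.castSucc) (fun j => t j.castSucc)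
      * NormedSpace.exp (t (Fin.last m) • adMatrix c (ζ (Fin.last m))) := by
  rw [expProd, List.ofFn_succ', List.concat_eq_append, List.prod_append, List.prod_singleton]
  rfl

theorem IsJacobiIdeal.isHomMod_expProd (hK : IsJacobiIdeal c K) {m : ℕ} (ζ : Fin m → Fin s → ℂ)
    (t : Fin m → ℝ) : IsHomMod c K (expProd c ζ t) := by
  induction m with
  | zero => simpa [expProd] using IsHomMod.one
  | succ m ih =>
    rw [expProd_succ]
    refine (ih _ _).mul ?_
    have := hK.isHomMod_exp ((t (Fin.last m) : ℂ) • ζ (Fin.last m))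
    rwa [adMatrix_smul, Complex.coe_smul] at this

/-- Differentiating the product of exponentials in its `β`-th time amounts, modulo `K`, to a left
multiplication by `ad`. -/
theorem IsJacobiIdeal.exists_hasDerivAt_expProd (hK : IsJacobiIdeal c K) {m : ℕ}
    (ζ : Fin m → Fin s → ℂ) (t : Fin m → ℝ) (β : Fin m) (w : Fin s → ℂ) :
    ∃ d, HasDerivAt (fun x => expProd c ζ (Function.update t β x) *ᵥ w) d (t β) ∧
      d - adMatrix c (expProd c (fun j : Fin β => ζ (j.castLE β.isLt.le))
        (fun j => t (j.castLE β.isLt.le)) *ᵥ ζ β) *ᵥ (expProd c ζ t *ᵥ w) ∈ K := by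
  induction m generalizing w with
  | zero => exact β.elim0
  | succ m ih =>
    cases β using Fin.lastCases with
    | last =>
      set P := expProd c (fun j => ζ j.castSucc) (fun j => t j.castSucc) with hP
      set D := adMatrix c (ζ (Fin.last m)) with hD
      refine ⟨P *ᵥ (D *ᵥ (NormedSpace.exp (t (Fin.last m) • D) *ᵥ w)), ?_, ?_⟩
      · have h1 := (hasDerivAt_const (t (Fin.last m)) P).matrix_mulVec
          ((hasDerivAt_exp_smul_const' D (t (Fin.last m))).matrix_mulVec
            (hasDerivAt_const (t (Fin.last m)) w))
        simp only [expProd_succ, ← Matrix.mulVec_mulVec, Function.update_self, ne_eq,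
          Fin.castSucc_ne_last, not_false_eq_true, Function.update_of_ne]
        rw [Matrix.mulVec_zero, add_zero, Matrix.zero_mulVec, zero_add,
          ← Matrix.mulVec_mulVec] at h1
        exact h1
      · rw [expProd_succ, ← Matrix.mulVec_mulVec]
        exact (hK.isHomMod_expProd _ _).hom _ _
    | cast β =>
      obtain ⟨d, hd, hdK⟩ := ih (fun j => ζ j.castSucc) (fun j => t j.castSucc) β
        (NormedSpace.exp (t (Fin.last m) • adMatrix c (ζ (Fin.last m))) *ᵥ w)
      refine ⟨d, ?_, ?_⟩
      · convert hd using 2 with x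
        rw [expProd_succ, ← Matrix.mulVec_mulVec,
          Function.update_of_ne (Fin.castSucc_ne_last β).symm]
        congr 2
        funext j
        by_cases h : j = β
        · subst h; simp
        · rw [Function.update_of_ne h, Function.update_of_ne (by simpa using h)]
      · rw [expProd_succ, ← Matrix.mulVec_mulVec]
        exact hdK

theorem contDiff_expProd {m : ℕ} (ζ : Fin m → Fin s → ℂ) :
    ContDiff ℝ ∞ (fun t : Fin m → ℝ => expProd c ζ t) := by
  induction m with
  | zero => simpa [expProd] using contDiff_const
  | succ m ih =>
    simp only [expProd_succ]
    refine ContDiff.mul ((ih _).comp (contDiff_pi.2 fun j => contDiff_apply ℝ ℝ j.castSucc)) ?_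
    have h : ContDiff ℝ ∞ (NormedSpace.exp : Matrix (Fin s) (Fin s) ℂ → _) :=
      contDiff_iff_contDiffAt.2 fun x => (NormedSpace.exp_analytic (𝕂 := ℝ) x).contDiffAt
    exact h.comp ((contDiff_apply ℝ ℝ (Fin.last m)).smul contDiff_const)

variable {ℓ : ℕ}

/-- The substitution `τ = -i t` turns the factors `exp (-τ ad η)` into `exp (t ad (i η))`. -/
theorem maurerCartanCoeff_eq (η : Fin ℓ → Fin s → ℂ) (t : Fin ℓ → ℝ) (α : Fin ℓ) :
    maurerCartanCoeff c η (fun j => -Complex.I * (t j : ℂ)) α =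
      expProd c (fun j : Fin α => Complex.I • η (j.castLE α.isLt.le))
        (fun j => t (j.castLE α.isLt.le)) *ᵥ η α := by
  simp only [maurerCartanCoeff, expProd, adMatrix_smul]
  congr 4
  funext j
  rw [← Complex.coe_smul, smul_smul]
  congr 2
  ring

theorem maurerCartanCoeff_zero (η : Fin ℓ → Fin s → ℂ) (α : Fin ℓ) :
    maurerCartanCoeff c η (fun j => -Complex.I * (((0 : EuclideanSpace ℝ (Fin ℓ)) j : ℝ) : ℂ)) α =
      η α := by
  rw [maurerCartanCoeff_eq]
  simp [expProd]

theorem contDiff_maurerCartanCoeff (η : Fin ℓ → Fin s → ℂ) (α : Fin ℓ) :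
    ContDiff ℝ ∞ (fun t : EuclideanSpace ℝ (Fin ℓ) =>
      maurerCartanCoeff c η (fun j => -Complex.I * (t j : ℂ)) α) := by
  let L : Matrix (Fin s) (Fin s) ℂ →ₗ[ℝ] (Fin s → ℂ) :=
    { toFun := fun B => B *ᵥ η α
      map_add' := fun B B' => Matrix.add_mulVec B B' _
      map_smul' := fun r B => Matrix.smul_mulVec r B _ }
  have h : ContDiff ℝ ∞ fun t : EuclideanSpace ℝ (Fin ℓ) =>
      (fun j : Fin α => t (j.castLE α.isLt.le)) := by fun_prop
  have h2 := L.toContinuousLinearMap.contDiff.comp ((contDiff_expProd (c := c)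
    (fun j : Fin α => Complex.I • η (j.castLE α.isLt.le))).comp h)
  have h3 : (fun t : EuclideanSpace ℝ (Fin ℓ) =>
      maurerCartanCoeff c η (fun j => -Complex.I * (t j : ℂ)) α) = _ :=
    funext fun t => maurerCartanCoeff_eq η t α
  rw [h3]
  exact h2

/-- The partial derivatives of the Maurer–Cartan coefficients, as ordinary derivatives. -/
theorem hasDerivAt_maurerCartanCoeff_update (η : Fin ℓ → Fin s → ℂ) (α β : Fin ℓ)
    (t : EuclideanSpace ℝ (Fin ℓ)) :
    HasDerivAt (fun x : ℝ =>
        maurerCartanCoeff c η (fun j => -Complex.I * (Function.update t α x j : ℝ)) β)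
      (fderiv ℝ (fun t : EuclideanSpace ℝ (Fin ℓ) =>
        maurerCartanCoeff c η (fun j => -Complex.I * (t j : ℂ)) β) t (EuclideanSpace.single α 1))
      (t α) := by
  have hd := ((contDiff_maurerCartanCoeff (c := c) η β).differentiable (by simp) t).hasFDerivAt
  have h1 := hd.comp_hasDerivAt_of_eq (t α) ((((hasDerivAt_id (t α)).sub_const (t α)).smul_const
    (EuclideanSpace.single α (1 : ℝ))).const_add t) (by simp)
  rw [one_smul] at h1
  refine h1.congr_of_eventuallyEq (.of_forall fun x => ?_)
  dsimp only [Function.comp_apply]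
  congr 1
  funext j
  by_cases h : j = α
  · subst h; simp
  · simp [h]

/-- `ω_β` depends on the coordinates before the `β`-th only. -/
theorem fderiv_maurerCartanCoeff_of_le (η : Fin ℓ → Fin s → ℂ) {α β : Fin ℓ} (h : β ≤ α)
    (t : EuclideanSpace ℝ (Fin ℓ)) :
    fderiv ℝ (fun t : EuclideanSpace ℝ (Fin ℓ) =>
      maurerCartanCoeff c η (fun j => -Complex.I * (t j : ℂ)) β) t
      (EuclideanSpace.single α 1) = 0 := by
  have h1 := hasDerivAt_maurerCartanCoeff_update (c := c) η α β t
  refine h1.unique ?_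
  refine (hasDerivAt_const (t α) (maurerCartanCoeff c η (fun j => -Complex.I * (t j : ℂ)) β))
    |>.congr_of_eventuallyEq (.of_forall fun x => ?_)
  dsimp only
  rw [maurerCartanCoeff_eq, maurerCartanCoeff_eq]
  congr 2
  funext j
  have : j.castLE β.isLt.le ≠ α := fun h' => by
    have h2 : (j : ℕ) = α := congrArg Fin.val h'
    have h3 : (β : ℕ) ≤ α := h
    omega
  rw [Function.update_of_ne this]

/-- The Maurer–Cartan equation `ad (ω_α) ω_β + ∂ω_β/∂τ^α = 0` for `α < β`, modulo `K`; for
`τ = -i t` the derivative `∂/∂τ^α` is `i ∂/∂t^α`. -/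
theorem IsJacobiIdeal.maurerCartan (hK : IsJacobiIdeal c K) (η : Fin ℓ → Fin s → ℂ) {α β : Fin ℓ}
    (h : α < β) (t : EuclideanSpace ℝ (Fin ℓ)) :
    adMatrix c (maurerCartanCoeff c η (fun j => -Complex.I * (t j : ℂ)) α) *ᵥ
        maurerCartanCoeff c η (fun j => -Complex.I * (t j : ℂ)) β +
      Complex.I • fderiv ℝ (fun t : EuclideanSpace ℝ (Fin ℓ) =>
        maurerCartanCoeff c η (fun j => -Complex.I * (t j : ℂ)) β) t
        (EuclideanSpace.single α 1) ∈ K := by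
  have h1 := hasDerivAt_maurerCartanCoeff_update (c := c) η α β t
  obtain ⟨d, hd, hdK⟩ := hK.exists_hasDerivAt_expProd
    (fun j : Fin β => Complex.I • η (j.castLE β.isLt.le)) (fun j => t (j.castLE β.isLt.le))
    ⟨α, h⟩ (η β)
  have hd' : d = fderiv ℝ (fun t : EuclideanSpace ℝ (Fin ℓ) =>
        maurerCartanCoeff c η (fun j => -Complex.I * (t j : ℂ)) β) t
        (EuclideanSpace.single α 1) := by
    refine hd.unique (h1.congr_of_eventuallyEq (.of_forall fun x => ?_))
    dsimp only
    rw [maurerCartanCoeff_eq]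
    congr 2
    funext j
    by_cases h' : j = ⟨α, h⟩
    · subst h'
      rw [Function.update_self]
      exact (Function.update_self (β := fun _ => ℝ) α x _).symm
    · rw [Function.update_of_ne h', Function.update_of_ne fun h2 => h' (by
        exact Fin.ext (congrArg (Fin.val (n := ℓ)) h2))]
  rw [← hd']
  rw [maurerCartanCoeff_eq, maurerCartanCoeff_eq]
  have h4 : expProd c (fun j : Fin α => Complex.I • η (j.castLE α.isLt.le))
        (fun j => t (j.castLE α.isLt.le)) *ᵥ (Complex.I • η α) =
        Complex.I • (expProd c (fun j : Fin α => Complex.I • η (j.castLE α.isLt.le))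
        (fun j => t (j.castLE α.isLt.le)) *ᵥ η α) := Matrix.mulVec_smul _ _ _
  have h5 : d - Complex.I • (adMatrix c
      (expProd c (fun j : Fin α => Complex.I • η (j.castLE α.isLt.le))
        (fun j => t (j.castLE α.isLt.le)) *ᵥ η α) *ᵥ
      (expProd c (fun j : Fin β => Complex.I • η (j.castLE β.isLt.le))
        (fun j => t (j.castLE β.isLt.le)) *ᵥ η β)) ∈ K := by
    rw [← Matrix.smul_mulVec, ← adMatrix_smul, ← h4]
    exact hdK
  have h6 := K.smul_mem Complex.I h5
  rw [smul_sub, smul_smul, Complex.I_mul_I, neg_one_smul, sub_neg_eq_add, add_comm] at h6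
  exact h6

end MaurerCartan

/-! ### CR structures from frames of their `(0,1)`-spaces -/

section Frames

variable {E H N : Type*} [NormedAddCommGroup E] [NormedSpace ℝ E] [TopologicalSpace H]
  {I : ModelWithCorners ℝ E H} [TopologicalSpace N] [ChartedSpace H N]

theorem mdifferentiableAt_pi {m : ℕ} {f : N → Fin m → E} {x : N}
    (hf : ∀ i, MDifferentiableAt I 𝓘(ℝ, E) (fun y => f y i) x) :
    MDifferentiableAt I 𝓘(ℝ, Fin m → E) f x := by
  rw [mdifferentiableAt_iff]
  refine ⟨continuousAt_pi.2 fun i => (hf i).continuousAt, ?_⟩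
  rw [differentiableWithinAt_pi]
  intro i
  exact ((mdifferentiableAt_iff _ _).1 (hf i)).2

variable [IsManifold I ∞ N]

/-- The coordinate expression of a tangent vector in the trivialization at `x`. -/
noncomputable def trivCoord (I : ModelWithCorners ℝ E H) [IsManifold I ∞ N] (x y : N)
    (v : TangentSpace I y) : E :=
  (trivializationAt E (TangentSpace I) x ⟨y, v⟩).2

theorem exists_linearEquiv_trivCoord {x y : N}
    (hy : y ∈ (trivializationAt E (TangentSpace I) x).baseSet) :
    ∃ L : TangentSpace I y ≃ₗ[ℝ] E, ∀ v, trivCoord I x y v = L v :=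
  ⟨(trivializationAt E (TangentSpace I) x).linearEquivAt ℝ y hy, fun v =>
    ((trivializationAt E (TangentSpace I) x).linearEquivAt_apply y hy v).symm⟩

theorem linearIndependent_trivCoord_iff {ι : Type*} {x y : N}
    (hy : y ∈ (trivializationAt E (TangentSpace I) x).baseSet) {e : ι → TangentSpace I y} :
    LinearIndependent ℝ (fun i => trivCoord I x y (e i)) ↔ LinearIndependent ℝ e := by
  obtain ⟨L, hL⟩ := exists_linearEquiv_trivCoord hy
  have : (fun i => trivCoord I x y (e i)) = L.toLinearMap ∘ e := funext fun i => hL _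
  rw [this]
  exact L.toLinearMap.linearIndependent_iff (LinearEquiv.ker _)

theorem mdifferentiableAt_trivCoord {V : ∀ y : N, TangentSpace I y} {x : N}
    (hV : MDiffAt (fun y => (⟨y, V y⟩ : TangentBundle I N)) x) :
    MDifferentiableAt I 𝓘(ℝ, E) (fun y => trivCoord I x y (V y)) x :=
  (mdifferentiableAt_section I V).1 hV

theorem eventually_mem_baseSet (x : N) :
    ∀ᶠ y in 𝓝 x, y ∈ (trivializationAt E (TangentSpace I) x).baseSet :=
  (trivializationAt E (TangentSpace I) x).open_baseSet.mem_nhds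
    (mem_baseSet_trivializationAt E (TangentSpace I) x)

theorem eventually_linearIndependent {m : ℕ}
    {e : Fin m → ∀ y : N, TangentSpace I y} {x : N}
    (he : ∀ i, MDiffAt (fun y => (⟨y, e i y⟩ : TangentBundle I N)) x)
    (hli : LinearIndependent ℝ fun i => e i x) :
    ∀ᶠ y in 𝓝 x, LinearIndependent ℝ fun i => e i y := by
  have h1 := (mdifferentiableAt_pi fun i => mdifferentiableAt_trivCoord (he i)).continuousAt
  have h2 := (linearIndependent_trivCoord_iff
    (mem_baseSet_trivializationAt E (TangentSpace I) x)).2 hli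
  filter_upwards [h1.eventually h2.eventually, eventually_mem_baseSet (I := I) x] with y hy hy'
  exact (linearIndependent_trivCoord_iff hy').1 hy

/-- A real vector field that near `x` is a combination of differentiable fields, linearly
independent at `x`, has differentiable coefficients. -/
theorem exists_mdifferentiableAt_coeff [FiniteDimensional ℝ E] {m : ℕ}
    {e : Fin m → ∀ y : N, TangentSpace I y} {V : ∀ y : N, TangentSpace I y} {x : N}
    (he : ∀ i, MDiffAt (fun y => (⟨y, e i y⟩ : TangentBundle I N)) x)
    (hV : MDiffAt (fun y => (⟨y, V y⟩ : TangentBundle I N)) x)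
    (hli : LinearIndependent ℝ fun i => e i x)
    (hspan : ∀ᶠ y in 𝓝 x, V y ∈ Submodule.span ℝ (range fun i => e i y)) :
    ∃ a : Fin m → N → ℝ, (∀ i, MDifferentiableAt I 𝓘(ℝ, ℝ) (a i) x) ∧
      ∀ᶠ y in 𝓝 x, V y = ∑ i, a i y • e i y := by
  let eh : N → Fin m → E := fun y i => trivCoord I x y (e i y)
  let Vh : N → E := fun y => trivCoord I x y (V y)
  have heh : MDifferentiableAt I 𝓘(ℝ, Fin m → E) eh x :=
    mdifferentiableAt_pi fun i => mdifferentiableAt_trivCoord (he i)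
  have hVh : MDifferentiableAt I 𝓘(ℝ, E) Vh x := mdifferentiableAt_trivCoord hV
  have hli' : LinearIndependent ℝ (eh x) := (linearIndependent_trivCoord_iff
    (mem_baseSet_trivializationAt E (TangentSpace I) x)).2 hli
  -- a left inverse of the coefficient map of the frame at `x`
  obtain ⟨Ψ, hΨ⟩ := (Fintype.linearCombination ℝ (eh x)).exists_leftInverse_of_injective
    (LinearMap.ker_eq_bot.2 (linearIndependent_iff_injective_fintypeLinearCombination.1 hli'))
  let Θ : (Fin m → E) →ₗ[ℝ] ((Fin m → ℝ) →L[ℝ] (Fin m → ℝ)) :=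
    { toFun := fun w => (Ψ ∘ₗ Fintype.linearCombination ℝ w).toContinuousLinearMap
      map_add' := fun w w' => by
        ext c i
        simp [Fintype.linearCombination_apply, Finset.sum_add_distrib]
      map_smul' := fun r w => by
        ext c i
        simp [Fintype.linearCombination_apply, Finset.mul_sum, mul_left_comm] }
  have hΘx : Θ (eh x) = 1 := by
    ext1 c
    exact LinearMap.congr_fun hΨ c
  have hu : IsUnit (Θ (eh x)) := hΘx ▸ isUnit_one
  have hΘd : MDifferentiableAt I 𝓘(ℝ, (Fin m → ℝ) →L[ℝ] (Fin m → ℝ))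
      (fun y => Ring.inverse (Θ (eh y))) x := by
    have h1 : DifferentiableAt ℝ (fun w => Ring.inverse (Θ w)) (eh x) :=
      DifferentiableAt.comp (g := Ring.inverse) (eh x) (differentiableAt_inverse (𝕜 := ℝ) hu)
        Θ.toContinuousLinearMap.differentiableAt
    exact h1.comp_mdifferentiableAt heh
  have hΘu : ∀ᶠ y in 𝓝 x, IsUnit (Θ (eh y)) :=
    (Θ.toContinuousLinearMap.continuous.continuousAt.comp heh.continuousAt).eventually
      (Units.isOpen.mem_nhds hu)
  have hΨd : MDifferentiableAt I 𝓘(ℝ, Fin m → ℝ) (fun y => Ψ (Vh y)) x :=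
    Ψ.toContinuousLinearMap.differentiableAt.comp_mdifferentiableAt hVh
  have had := hΘd.clm_apply hΨd
  refine ⟨fun i y => Ring.inverse (Θ (eh y)) (Ψ (Vh y)) i, fun i =>
    (ContinuousLinearMap.proj (R := ℝ) (φ := fun _ : Fin m => ℝ) i).differentiableAt
      |>.comp_mdifferentiableAt had, ?_⟩
  filter_upwards [hspan, hΘu, eventually_mem_baseSet (I := I) x] with y hy hyu hyb
  obtain ⟨c, hc⟩ := (Submodule.mem_span_range_iff_exists_fun ℝ).1 hy
  have h1 : Ψ (Vh y) = Θ (eh y) c := by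
    obtain ⟨L, hL⟩ := exists_linearEquiv_trivCoord hyb
    simp only [Vh, Θ, eh, hL, ← hc, map_sum, map_smul]
    simp [Fintype.linearCombination_apply]
  have h2 : Ring.inverse (Θ (eh y)) (Ψ (Vh y)) = c := by
    rw [h1, ← mul_apply_eq_comp, Ring.inverse_mul_cancel _ hyu]
    rfl
  rw [h2, hc]

/-- A section of a complex distribution `L` without purely imaginary vectors is, near `x`, a
combination with differentiable real coefficients of a real frame of `L`. -/
theorem exists_mdifferentiableAt_coeff_complex [FiniteDimensional ℝ E] {m : ℕ} {x : N}
    {F : Fin m → CField I N} {Z : CField I N} (hF : ∀ i, (F i).DiffAt x) (hZ : Z.DiffAt x)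
    (hli : ∀ᶠ y in 𝓝 x, LinearIndependent ℝ fun i => (F i y).re)
    (hspan : ∀ᶠ y in 𝓝 x, Z y ∈ Submodule.span ℝ (range fun i => F i y)) :
    ∃ a : Fin m → N → ℂ, (∀ i, MDifferentiableAt I 𝓘(ℝ, ℂ) (a i) x) ∧
      ∀ᶠ y in 𝓝 x, Z y = (∑ i, fun y => a i y • F i y) y := by
  have hs : ∀ᶠ y in 𝓝 x, (Z y).re ∈ Submodule.span ℝ (range fun i => (F i y).re) := by
    filter_upwards [hspan] with y hy
    have := Submodule.mem_map_of_mem (f := ComplexVec.reₗ) hy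
    rwa [Submodule.map_span, ← range_comp] at this
  obtain ⟨a, ha, haZ⟩ := exists_mdifferentiableAt_coeff (fun i => (hF i).1) hZ.1
    hli.self_of_nhds hs
  refine ⟨fun i y => a i y, fun i => Complex.ofRealCLM.differentiableAt.comp_mdifferentiableAt
    (ha i), ?_⟩
  filter_upwards [haZ, hli, hspan] with y hy hyl hys
  obtain ⟨b, hb⟩ := (Submodule.mem_span_range_iff_exists_fun ℝ).1 hys
  have hb' : (Z y).re = ∑ i, b i • (F i y).re := by
    rw [← hb]
    exact ComplexVec.re_sum_smul b fun i => F i y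
  have hab : b = fun i => a i y := funext fun i => by
    have h0 : ∑ i, (b i - a i y) • (F i y).re = 0 := by
      simp only [sub_smul, Finset.sum_sub_distrib, ← hb', ← hy, sub_self]
    exact sub_eq_zero.1 (Fintype.linearIndependent_iff.1 hyl _ h0 i)
  rw [← hb, Finset.sum_apply, hab]
  rfl

/-- A complex distribution spanned by fields whose mutual brackets are sections of it is
involutive. -/
theorem bracket_mem_of_frame [FiniteDimensional ℝ E] {m : ℕ} {x : N}
    {L : Submodule ℂ (ComplexVec (TangentSpace I x))}
    {F : Fin m → CField I N} {Z W : CField I N} (hF : ∀ i, (F i).DiffAt x)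
    (hZ : Z.DiffAt x) (hW : W.DiffAt x)
    (hli : ∀ᶠ y in 𝓝 x, LinearIndependent ℝ fun i => (F i y).re)
    (hZspan : ∀ᶠ y in 𝓝 x, Z y ∈ Submodule.span ℝ (range fun i => F i y))
    (hWspan : ∀ᶠ y in 𝓝 x, W y ∈ Submodule.span ℝ (range fun i => F i y))
    (hFL : ∀ i, F i x ∈ L) (hFF : ∀ i j, (F i).bracket (F j) x ∈ L) :
    Z.bracket W x ∈ L := by
  have : CompleteSpace E := FiniteDimensional.complete ℝ E
  obtain ⟨a, ha, haZ⟩ := exists_mdifferentiableAt_coeff_complex hF hZ hli hZspan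
  obtain ⟨b, hb, hbW⟩ := exists_mdifferentiableAt_coeff_complex hF hW hli hWspan
  rw [CField.bracket_congr haZ hbW,
    CField.bracket_sum_left fun i _ => CField.DiffAt.smul (ha i) (hF i)]
  refine sum_mem fun i _ => ?_
  rw [CField.bracket_smul_left (ha i) (hF i),
    CField.bracket_sum_right fun j _ => CField.DiffAt.smul (hb j) (hF j)]
  refine sub_mem (L.smul_mem _ (sum_mem fun j _ => ?_)) (L.smul_mem _ (hFL i))
  rw [CField.bracket_smul_right (hb j) (hF j)]
  exact add_mem (L.smul_mem _ (hFL j)) (L.smul_mem _ (hFF i j))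

/-- A CR structure can be prescribed by its `(0,1)`-distribution `L`, given locally by real frames
`F` whose real parts are independent and whose mutual brackets are sections of `L`. -/
theorem exists_crStructure_of_frames [FiniteDimensional ℝ E] {Ω : Set N} {n k : ℕ}
    (hΩ : IsOpen Ω) (hdim : Module.finrank ℝ E = 2 * n + k)
    (L : ∀ x : N, Submodule ℂ (ComplexVec (TangentSpace I x)))
    (hframe : ∀ x ∈ Ω, ∃ u ⊆ Ω, IsOpen u ∧ x ∈ u ∧ ∃ F : Fin (2 * n) → CField I N,
      (∀ i, (F i).SmoothOn u) ∧ ∀ y ∈ u, (LinearIndependent ℝ fun i => (F i y).re) ∧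
        (∀ i, F i y ∈ L y) ∧ (∀ z ∈ L y, z ∈ Submodule.span ℝ (range fun i => F i y)) ∧
        ∀ i j, (F i).bracket (F j) y ∈ L y) :
    ∃ S : CRStructure I Ω n k, ∀ x ∈ Ω, S.D01 x = L x := by
  choose J hJ using fun x => exists_endomorphism (L x)
  have hL (x : N) (hx : x ∈ Ω) : ∀ z ∈ L x, z.re = 0 → z = 0 := by
    intro z hz hre
    obtain ⟨u, -, -, hxu, F, -, hF⟩ := hframe x hx
    obtain ⟨hli, -, hspan, -⟩ := hF x hxu
    obtain ⟨b, rfl⟩ := (Submodule.mem_span_range_iff_exists_fun ℝ).1 (hspan z hz)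
    have hb : ∑ i, b i • (F i x).re = 0 := by
      rw [← hre]
      exact (ComplexVec.re_sum_smul b fun i => F i x).symm
    simp [Fintype.linearIndependent_iff.1 hli b hb]
  have hJD (x : N) (hx : x ∈ Ω) := (hJ x (hL x hx)).2
  refine ⟨
    { isOpen := hΩ
      dim_eq := hdim
      D := fun x => rePart (L x)
      J := J
      J_sq := fun x hx => (hJ x (hL x hx)).1
      exists_frame := fun x hx => ?_
      involutive := fun u hu huo Z W hZ hW hZL hWL y hy => ?_ }, hJD⟩
  · obtain ⟨u, huΩ, huo, hxu, F, hFs, hF⟩ := hframe x hx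
    classical
    let e : Fin (2 * n) → ∀ y : N, rePart (L y) := fun i y =>
      if h : y ∈ u then ⟨(F i y).re, F i y, (hF y h).2.1 i, rfl⟩ else 0
    have he (i) (y : N) (hy : y ∈ u) :
        e i y = ⟨(F i y).re, F i y, (hF y hy).2.1 i, rfl⟩ := dif_pos hy
    have hJe (i) (y : N) (hy : y ∈ u) : (J y (e i y) : TangentSpace I y) = (F i y).im := by
      have h1 : F i y ∈ antiHolomorphic (rePart (L y)) (J y) := by
        rw [hJD y (huΩ hy)]; exact (hF y hy).2.1 i
      obtain ⟨a, b, hab, h1, -⟩ := h1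
      have ha : e i y = a := by
        rw [he i y hy]; ext; simp [hab]
      rw [ha, h1, hab]
    refine ⟨u, huΩ, huo, hxu, e, fun i => (hFs i).1.congr fun y hy => ?_,
      fun i => (hFs i).2.congr fun y hy => ?_, fun y hy => ⟨?_, ?_⟩⟩
    · simp only [he i y hy]
    · simp only [hJe i y hy]
    · refine LinearIndependent.of_comp (rePart (L y)).subtype ?_
      convert (hF y hy).1 using 1
      funext i
      simp [he i y hy]
    · rw [eq_top_iff]
      rintro ⟨_, z, hz, rfl⟩ -
      obtain ⟨b, rfl⟩ := (Submodule.mem_span_range_iff_exists_fun ℝ).1 ((hF y hy).2.2.1 z hz)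
      refine (Submodule.mem_span_range_iff_exists_fun ℝ).2 ⟨b, ?_⟩
      ext
      simp [he _ y hy]
  · rw [hJD y (hu hy)]
    obtain ⟨u', huΩ', huo', hyu', F, hFs, hF⟩ := hframe y (hu hy)
    have hnear : ∀ᶠ z in 𝓝 y, z ∈ u' := huo'.mem_nhds hyu'
    have hnear' : ∀ᶠ z in 𝓝 y, z ∈ u := huo.mem_nhds hy
    refine bracket_mem_of_frame (fun i => (hFs i).diffAt huo' hyu') (hZ.diffAt huo hy)
      (hW.diffAt huo hy) (hnear.mono fun z hz => (hF z hz).1) ?_ ?_ (hF y hyu').2.1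
      (hF y hyu').2.2.2
    · filter_upwards [hnear, hnear'] with z hz hz'
      exact (hF z hz).2.2.1 _ (hJD z (hu hz') ▸ hZL z hz')
    · filter_upwards [hnear, hnear'] with z hz hz'
      exact (hF z hz).2.2.1 _ (hJD z (hu hz') ▸ hWL z hz')

end Frames

/-! ### The combinations of the symmetries form a Lie algebra modulo `D^{0,1}` -/

section SymmetryAlgebra

variable {E M : Type*} [NormedAddCommGroup E] [NormedSpace ℝ E] [FiniteDimensional ℝ E]
  [TopologicalSpace M] [ChartedSpace E M] [IsManifold 𝓘(ℝ, E) ∞ M] {n k s : ℕ}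

/-- The combination `∑ γ, v γ • X γ` of complex vector fields with constant coefficients. -/
noncomputable def comb (X : Fin s → CField 𝓘(ℝ, E) M) (v : Fin s → ℂ) : CField 𝓘(ℝ, E) M :=
  ∑ γ, v γ • X γ

omit [FiniteDimensional ℝ E] [IsManifold 𝓘(ℝ, E) ∞ M] in
theorem comb_apply (X : Fin s → CField 𝓘(ℝ, E) M) (v : Fin s → ℂ) (x : M) :
    comb X v x = ∑ γ, v γ • X γ x := by
  simp [comb, Finset.sum_apply]

omit [FiniteDimensional ℝ E] [IsManifold 𝓘(ℝ, E) ∞ M] in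
theorem comb_sub (X : Fin s → CField 𝓘(ℝ, E) M) (v w : Fin s → ℂ) :
    comb X (v - w) = comb X v - comb X w := by
  simp [comb, sub_smul]

omit [FiniteDimensional ℝ E] [IsManifold 𝓘(ℝ, E) ∞ M] in
theorem comb_add (X : Fin s → CField 𝓘(ℝ, E) M) (v w : Fin s → ℂ) :
    comb X (v + w) = comb X v + comb X w := by
  simp [comb, add_smul, Finset.sum_add_distrib]

omit [FiniteDimensional ℝ E] [IsManifold 𝓘(ℝ, E) ∞ M] in
theorem comb_smul (X : Fin s → CField 𝓘(ℝ, E) M) (a : ℂ) (v : Fin s → ℂ) :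
    comb X (a • v) = a • comb X v := by
  simp [comb, Finset.smul_sum, mul_smul]

variable {X : Fin s → CField 𝓘(ℝ, E) M} (hX : ∀ α, (X α).SmoothOn univ)

include hX

omit [FiniteDimensional ℝ E] in
theorem smoothOn_comb (v : Fin s → ℂ) : (comb X v).SmoothOn univ :=
  CField.SmoothOn.sum fun γ _ => (hX γ).const_smul _

theorem bracket_comb_left {Z : CField 𝓘(ℝ, E) M} (v : Fin s → ℂ) (x : M) :
    (comb X v).bracket Z x = ∑ γ, v γ • (X γ).bracket Z x := by
  have : CompleteSpace E := FiniteDimensional.complete ℝ E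
  have hd (γ) : (X γ).DiffAt x := (hX γ).diffAt isOpen_univ (mem_univ x)
  rw [comb, CField.bracket_sum_left fun γ _ => (hd γ).const_smul _]
  exact Finset.sum_congr rfl fun γ _ => CField.bracket_const_smul_left _ (hd γ)

theorem bracket_comb_comb (v w : Fin s → ℂ) (x : M) :
    (comb X v).bracket (comb X w) x = ∑ γ, ∑ δ, (v γ * w δ) • (X γ).bracket (X δ) x := by
  rw [bracket_comb_left hX]
  refine Finset.sum_congr rfl fun γ _ => ?_
  rw [CField.bracket_swap, bracket_comb_left hX, ← Finset.sum_neg_distrib, Finset.smul_sum]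
  refine Finset.sum_congr rfl fun δ _ => ?_
  rw [CField.bracket_swap (X δ)]
  module

variable (S : CRStructure 𝓘(ℝ, E) (univ : Set M) n k)

/-- The coefficients of those combinations of the fields `X γ` that are sections of `D^{0,1}`. -/
noncomputable def sectionCoeffs (S : CRStructure 𝓘(ℝ, E) (univ : Set M) n k)
    (X : Fin s → CField 𝓘(ℝ, E) M) :
    Submodule ℂ (Fin s → ℂ) where
  carrier := {v | ∀ x, comb X v x ∈ S.D01 x}
  zero_mem' x := by simp [comb_apply]
  add_mem' hv hw x := by rw [comb_add]; exact add_mem (hv x) (hw x)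
  smul_mem' a v hv x := by rw [comb_smul]; exact Submodule.smul_mem _ a (hv x)

variable {S} (hnorm : ∀ α, S.Normalises (X α)) {c : Fin s → Fin s → Fin s → ℂ}
  (hc : ∀ α β x, (X α).bracket (X β) x - ∑ γ, c α β γ • X γ x ∈ S.D01 x)

include hnorm in
theorem normalises_comb (v : Fin s → ℂ) : S.Normalises (comb X v) := by
  intro u hu huo Z hZ hZD y hy
  rw [bracket_comb_left hX]
  exact sum_mem fun γ _ => Submodule.smul_mem _ _ (hnorm γ u hu huo Z hZ hZD y hy)

include hc in
theorem bracket_comb_sub_mem (v w : Fin s → ℂ) (x : M) :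
    ((comb X v).bracket (comb X w) - comb X (adMatrix c v *ᵥ w)) x ∈ S.D01 x := by
  have h : comb X (adMatrix c v *ᵥ w) x = ∑ γ, ∑ δ, (v γ * w δ) • ∑ κ, c γ δ κ • X κ x := by
    simp only [comb_apply, adMatrix_mulVec_apply, Finset.sum_smul, Finset.smul_sum, smul_smul]
    exact Finset.sum_comm.trans ((Finset.sum_congr rfl fun _ _ => Finset.sum_comm).trans
      Finset.sum_comm)
  rw [Pi.sub_apply, bracket_comb_comb hX, h, ← Finset.sum_sub_distrib]
  refine sum_mem fun γ _ => ?_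
  rw [← Finset.sum_sub_distrib]
  refine sum_mem fun δ _ => ?_
  rw [← smul_sub]
  exact Submodule.smul_mem _ _ (hc γ δ x)

include hnorm hc in
/-- The combinations of the `X γ`, modulo sections of `D^{0,1}`, form a Lie algebra with the
structure constants `c`: this is the Jacobi identity of vector fields. -/
theorem isJacobiIdeal_sectionCoeffs : IsJacobiIdeal c (sectionCoeffs S X) where
  ideal u v hv x := by
    have h1 := bracket_comb_sub_mem hX hc u v x
    have h2 := normalises_comb hX hnorm u univ (subset_univ _) isOpen_univ _ (smoothOn_comb hX v)
      (fun y _ => hv y) x (mem_univ x)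
    simpa using sub_mem h2 h1
  jacobi u v w x := by
    have : CompleteSpace E := FiniteDimensional.complete ℝ E
    have hs := smoothOn_comb hX
    have hsb (a b : Fin s → ℂ) := (hs a).bracket isOpen_univ (hs b)
    -- an inner bracket may be replaced by the corresponding combination, modulo `D^{0,1}`
    have key (a b d : Fin s → ℂ) :
        (comb X a).bracket ((comb X b).bracket (comb X d)) x -
          comb X (adMatrix c a *ᵥ (adMatrix c b *ᵥ d)) x ∈ S.D01 x := by
      have h1 := bracket_comb_sub_mem hX hc a (adMatrix c b *ᵥ d) x
      have h2 := normalises_comb hX hnorm a univ (subset_univ _) isOpen_univ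
        ((comb X b).bracket (comb X d) + (-1 : ℂ) • comb X (adMatrix c b *ᵥ d))
        ((hsb b d).add ((hs _).const_smul _)) (fun y _ => by
          have := bracket_comb_sub_mem hX hc b d y
          rwa [neg_one_smul, ← sub_eq_add_neg]) x (mem_univ x)
      rw [CField.bracket_add_right ((hsb b d).diffAt isOpen_univ (mem_univ x))
        (((hs _).const_smul _).diffAt isOpen_univ (mem_univ x)),
        CField.bracket_const_smul_right _ ((hs _).diffAt isOpen_univ (mem_univ x)), neg_one_smul]
        at h2
      have := add_mem h1 h2
      rw [Pi.sub_apply] at this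
      convert this using 1
      abel
    have key' (a b d : Fin s → ℂ) :
        ((comb X a).bracket (comb X b)).bracket (comb X d) x -
          comb X (adMatrix c (adMatrix c a *ᵥ b) *ᵥ d) x ∈ S.D01 x := by
      have h1 := bracket_comb_sub_mem hX hc (adMatrix c a *ᵥ b) d x
      have h2 := normalises_comb hX hnorm d univ (subset_univ _) isOpen_univ
        ((comb X a).bracket (comb X b) + (-1 : ℂ) • comb X (adMatrix c a *ᵥ b))
        ((hsb a b).add ((hs _).const_smul _)) (fun y _ => by
          have := bracket_comb_sub_mem hX hc a b y
          rwa [neg_one_smul, ← sub_eq_add_neg]) x (mem_univ x)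
      rw [CField.bracket_add_right ((hsb a b).diffAt isOpen_univ (mem_univ x))
        (((hs _).const_smul _).diffAt isOpen_univ (mem_univ x)),
        CField.bracket_const_smul_right _ ((hs _).diffAt isOpen_univ (mem_univ x)), neg_one_smul,
        CField.bracket_swap (comb X d), CField.bracket_swap (comb X d)] at h2
      have := sub_mem h1 h2
      rw [Pi.sub_apply] at this
      convert this using 1
      abel
    have jac := CField.bracket_bracket (hs u) (hs v) (hs w) x
    have h := sub_mem (add_mem (key' u v w) (key v u w)) (key u v w)
    rw [jac] at h
    simp only [comb_sub, comb_add, Pi.sub_apply, Pi.add_apply]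
    convert h using 1
    abel

end SymmetryAlgebra

/-! ### Fields on the product with a Euclidean factor -/

section LiftedFields

variable {E M : Type*} [NormedAddCommGroup E] [NormedSpace ℝ E] [TopologicalSpace M]
  [ChartedSpace E M] {ℓ : ℕ}

/-- The horizontal lift to `M × ℝ^ℓ` of a complex vector field on `M`. Its real and imaginary parts,
like those of the coordinate fields, are of the form `prodConstField A v` by definition. -/
noncomputable def liftField (ℓ : ℕ) (Z : CField 𝓘(ℝ, E) M) :
    CField (prodModel E ℓ) (M × EuclideanSpace ℝ (Fin ℓ)) :=
  fun z => horizontal z.1 z.2 (Z z.1)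

variable [IsManifold 𝓘(ℝ, E) ∞ M]

theorem mdifferentiableAt_zeroField (q : M) :
    MDiffAt (fun y => (⟨y, 0⟩ : TangentBundle 𝓘(ℝ, E) M)) q := by
  exact CField.diffAt_zero.1

theorem smoothOn_liftField {Z : CField 𝓘(ℝ, E) M} {u : Set M} (hZ : Z.SmoothOn u) :
    (liftField ℓ Z).SmoothOn (Prod.fst ⁻¹' u) :=
  ⟨smoothFieldOn_prodConstField hZ.1 0, smoothFieldOn_prodConstField hZ.2 0⟩

theorem smoothOn_coordField (α : Fin ℓ) : (coordField (E := E) (M := M) α).SmoothOn univ :=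
  have h : SmoothFieldOn 𝓘(ℝ, E) (fun _ : M => 0) univ := CField.smoothOn_zero.1
  ⟨smoothFieldOn_prodConstField h _, smoothFieldOn_prodConstField h _⟩

variable [CompleteSpace E]

theorem bracket_liftField_liftField {Z W : CField 𝓘(ℝ, E) M} {q : M}
    {t : EuclideanSpace ℝ (Fin ℓ)} (hZ : Z.DiffAt q) (hW : W.DiffAt q) :
    (liftField ℓ Z).bracket (liftField ℓ W) (q, t) = horizontal q t (Z.bracket W q) := by
  ext1
  · refine (congrArg₂ (· - ·) (mlieBracket_prodConstField hZ.1 hW.1)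
      (mlieBracket_prodConstField hZ.2 hW.2)).trans ?_
    exact Prod.ext rfl (sub_zero _)
  · refine (congrArg₂ (· + ·) (mlieBracket_prodConstField hZ.1 hW.2)
      (mlieBracket_prodConstField hZ.2 hW.1)).trans ?_
    exact Prod.ext rfl (add_zero _)

theorem mlieBracket_prodConstField_zero_left {A : ∀ q : M, TangentSpace 𝓘(ℝ, E) q}
    {v w : EuclideanSpace ℝ (Fin ℓ)} {q : M} {t : EuclideanSpace ℝ (Fin ℓ)}
    (hA : MDiffAt (fun y => (⟨y, A y⟩ : TangentBundle 𝓘(ℝ, E) M)) q) :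
    VectorField.mlieBracket (prodModel E ℓ) (prodConstField (fun _ => 0) v)
      (prodConstField A w) (q, t) = 0 := by
  refine (mlieBracket_prodConstField (mdifferentiableAt_zeroField q) hA).trans ?_
  refine Prod.ext ?_ rfl
  exact congrFun (VectorField.mlieBracket_zero_left (I := 𝓘(ℝ, E)) (W := A)) q

theorem bracket_coordField_liftField (α : Fin ℓ) {Z : CField 𝓘(ℝ, E) M} {q : M}
    {t : EuclideanSpace ℝ (Fin ℓ)} (hZ : Z.DiffAt q) :
    (coordField α).bracket (liftField ℓ Z) (q, t) = 0 := by
  ext1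
  · exact (congrArg₂ (· - ·) (mlieBracket_prodConstField_zero_left hZ.1)
      (mlieBracket_prodConstField_zero_left hZ.2)).trans (sub_zero 0)
  · exact (congrArg₂ (· + ·) (mlieBracket_prodConstField_zero_left hZ.2)
      (mlieBracket_prodConstField_zero_left hZ.1)).trans (add_zero 0)

theorem bracket_coordField_coordField (α β : Fin ℓ) (z : M × EuclideanSpace ℝ (Fin ℓ)) :
    (coordField (E := E) α).bracket (coordField β) z = 0 := by
  have h := mdifferentiableAt_zeroField (E := E) z.1
  ext1
  · exact (congrArg₂ (· - ·) (mlieBracket_prodConstField_zero_left h)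
      (mlieBracket_prodConstField_zero_left h)).trans (sub_zero 0)
  · exact (congrArg₂ (· + ·) (mlieBracket_prodConstField_zero_left h)
      (mlieBracket_prodConstField_zero_left h)).trans (add_zero 0)

omit [IsManifold 𝓘(ℝ, E) ∞ M] [CompleteSpace E] in
theorem mvfderiv_snd {f : EuclideanSpace ℝ (Fin ℓ) → ℂ} {q : M}
    {t : EuclideanSpace ℝ (Fin ℓ)} (hf : DifferentiableAt ℝ f t)
    (w : TangentSpace (prodModel E ℓ) (q, t)) :
      mvfderiv (prodModel E ℓ) (fun z : M × EuclideanSpace ℝ (Fin ℓ) => f z.2) (q, t) w =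
        fderiv ℝ f t (w : E × EuclideanSpace ℝ (Fin ℓ)).2 := by
  have h := mfderiv_comp (I := prodModel E ℓ) (I' := 𝓘(ℝ, EuclideanSpace ℝ (Fin ℓ)))
    (I'' := 𝓘(ℝ, ℂ)) ((q, t) : M × EuclideanSpace ℝ (Fin ℓ)) (g := f) (f := Prod.snd)
    hf.mdifferentiableAt mdifferentiableAt_snd
  have h' : mfderiv (prodModel E ℓ) 𝓘(ℝ, ℂ) (fun z : M × EuclideanSpace ℝ (Fin ℓ) => f z.2)
      (q, t) = _ := h
  simp only [mvfderiv, h', ContinuousLinearMap.comp_apply]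
  rw [mfderiv_eq_fderiv, mfderiv_snd]
  rfl

omit [IsManifold 𝓘(ℝ, E) ∞ M] [CompleteSpace E] in
/-- A function of `t` alone is constant along horizontal vectors. -/
theorem cderiv_snd_horizontal {f : EuclideanSpace ℝ (Fin ℓ) → ℂ} {q : M}
    {t : EuclideanSpace ℝ (Fin ℓ)} (hf : DifferentiableAt ℝ f t)
    (v : ComplexVec (TangentSpace 𝓘(ℝ, E) q)) :
    cderiv (I := prodModel E ℓ) (fun z : M × EuclideanSpace ℝ (Fin ℓ) => f z.2) (q, t)
      (horizontal q t v) = 0 := by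
  rw [cderiv, mvfderiv_snd hf, mvfderiv_snd hf]
  have h1 : ((horizontal q t v).re : E × EuclideanSpace ℝ (Fin ℓ)).2 = 0 := rfl
  have h2 : ((horizontal q t v).im : E × EuclideanSpace ℝ (Fin ℓ)).2 = 0 := rfl
  rw [h1, h2]
  simp

omit [IsManifold 𝓘(ℝ, E) ∞ M] [CompleteSpace E] in
theorem cderiv_snd_coordField {f : EuclideanSpace ℝ (Fin ℓ) → ℂ} {z : M × EuclideanSpace ℝ (Fin ℓ)}
    (hf : DifferentiableAt ℝ f z.2) (α : Fin ℓ) :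
    cderiv (I := prodModel E ℓ) (fun z : M × EuclideanSpace ℝ (Fin ℓ) => f z.2) z
      (coordField α z) = fderiv ℝ f z.2 (EuclideanSpace.single α 1) := by
  obtain ⟨q, t⟩ := z
  rw [cderiv, mvfderiv_snd hf, mvfderiv_snd hf]
  simp [coordField]

end LiftedFields

section TwistedFields

variable {E M : Type*} [NormedAddCommGroup E] [NormedSpace ℝ E] [FiniteDimensional ℝ E]
  [TopologicalSpace M] [ChartedSpace E M] {s ℓ : ℕ}

/-- The horizontal field `∑ γ, λ^γ(t) X_γ` on `M × ℝ^ℓ`. -/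
noncomputable def twist (X : Fin s → CField 𝓘(ℝ, E) M)
    (lam : EuclideanSpace ℝ (Fin ℓ) → Fin s → ℂ) :
    CField (prodModel E ℓ) (M × EuclideanSpace ℝ (Fin ℓ)) :=
  ∑ γ, fun z => lam z.2 γ • liftField ℓ (X γ) z

omit [FiniteDimensional ℝ E] in
theorem twist_apply (X : Fin s → CField 𝓘(ℝ, E) M)
    (lam : EuclideanSpace ℝ (Fin ℓ) → Fin s → ℂ) (q : M) (t : EuclideanSpace ℝ (Fin ℓ)) :
    twist X lam (q, t) = horizontal q t (comb X (lam t) q) := by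
  rw [twist, Finset.sum_apply, comb_apply, map_sum]
  exact Finset.sum_congr rfl fun γ _ => ((horizontal q t).map_smul _ _).symm

variable [IsManifold 𝓘(ℝ, E) ∞ M] {X : Fin s → CField 𝓘(ℝ, E) M}
  (hX : ∀ α, (X α).SmoothOn univ) {lam μ : EuclideanSpace ℝ (Fin ℓ) → Fin s → ℂ}
  (hlam : ContDiff ℝ ∞ lam) (hμ : ContDiff ℝ ∞ μ)

include hX hlam

omit [FiniteDimensional ℝ E] in
theorem smoothOn_twist : (twist X lam).SmoothOn univ := by
  refine CField.SmoothOn.sum fun γ _ => CField.SmoothOn.smul ?_ (smoothOn_liftField (hX γ))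
  exact ((contDiff_pi.1 hlam γ).contMDiff.comp contMDiff_snd).contMDiffOn

theorem bracket_twist_left {W : CField (prodModel E ℓ) (M × EuclideanSpace ℝ (Fin ℓ))}
    (z : M × EuclideanSpace ℝ (Fin ℓ)) :
    (twist X lam).bracket W z = ∑ γ, (lam z.2 γ • (liftField ℓ (X γ)).bracket W z -
      cderiv (fun z : M × EuclideanSpace ℝ (Fin ℓ) => lam z.2 γ) z (W z) •
        liftField ℓ (X γ) z) := by
  have : CompleteSpace E := FiniteDimensional.complete ℝ E
  have hm (γ) : MDifferentiableAt (prodModel E ℓ) 𝓘(ℝ, ℂ)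
      (fun z : M × EuclideanSpace ℝ (Fin ℓ) => lam z.2 γ) z :=
    ((contDiff_pi.1 hlam γ).contMDiff.comp contMDiff_snd).mdifferentiable (by simp) z
  have hd (γ) : (liftField ℓ (X γ)).DiffAt z :=
    (smoothOn_liftField (hX γ)).diffAt isOpen_univ (mem_univ z)
  rw [twist, CField.bracket_sum_left fun γ _ => CField.DiffAt.smul (hm γ) (hd γ)]
  exact Finset.sum_congr rfl fun γ _ => CField.bracket_smul_left (hm γ) (hd γ)

theorem bracket_twist_liftField {Z : CField 𝓘(ℝ, E) M} {q : M} (hZ : Z.DiffAt q)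
    (t : EuclideanSpace ℝ (Fin ℓ)) :
    (twist X lam).bracket (liftField ℓ Z) (q, t) =
      horizontal q t ((comb X (lam t)).bracket Z q) := by
  have : CompleteSpace E := FiniteDimensional.complete ℝ E
  rw [bracket_twist_left hX hlam, bracket_comb_left hX, map_sum]
  refine Finset.sum_congr rfl fun γ _ => ?_
  rw [bracket_liftField_liftField ((hX γ).diffAt isOpen_univ (mem_univ q)) hZ, liftField,
    cderiv_snd_horizontal ((contDiff_pi.1 hlam γ).differentiable (by simp) t), zero_smul, sub_zero,
    map_smul]

theorem bracket_twist_coordField (q : M) (t : EuclideanSpace ℝ (Fin ℓ)) (α : Fin ℓ) :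
    (twist X lam).bracket (coordField α) (q, t) =
      -horizontal q t (comb X (fderiv ℝ lam t (EuclideanSpace.single α 1)) q) := by
  have : CompleteSpace E := FiniteDimensional.complete ℝ E
  rw [bracket_twist_left hX hlam, comb_apply, map_sum, ← Finset.sum_neg_distrib]
  refine Finset.sum_congr rfl fun γ _ => ?_
  have hd := hlam.differentiable (by simp) t
  rw [CField.bracket_swap, bracket_coordField_liftField α
    ((hX γ).diffAt isOpen_univ (mem_univ q)), cderiv_snd_coordField
    (f := fun t => lam t γ) (z := (q, t))
    ((contDiff_pi.1 hlam γ).differentiable (by simp) t), map_smul, neg_zero, smul_zero, zero_sub,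
    fderiv_apply hd]
  rfl

include hμ in
theorem bracket_twist_twist (q : M) (t : EuclideanSpace ℝ (Fin ℓ)) :
    (twist X lam).bracket (twist X μ) (q, t) =
      horizontal q t ((comb X (lam t)).bracket (comb X (μ t)) q) := by
  rw [bracket_twist_left hX hlam, bracket_comb_left hX, map_sum]
  refine Finset.sum_congr rfl fun γ _ => ?_
  rw [twist_apply, cderiv_snd_horizontal ((contDiff_pi.1 hlam γ).differentiable (by simp) t),
    zero_smul, sub_zero, CField.bracket_swap, bracket_twist_liftField hX hμ
    ((hX γ).diffAt isOpen_univ (mem_univ q)), ← map_neg, ← CField.bracket_swap, map_smul]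

include hμ in
/-- The bracket of `∑ γ, λ^γ(t) X_γ + i ∂_α` and `∑ γ, μ^γ(t) X_γ + i ∂_β`. -/
theorem bracket_twist_add_coordField (α β : Fin ℓ) (q : M) (t : EuclideanSpace ℝ (Fin ℓ)) :
    (twist X lam + Complex.I • coordField α).bracket (twist X μ + Complex.I • coordField β) (q, t) =
      horizontal q t ((comb X (lam t)).bracket (comb X (μ t)) q
        + Complex.I • comb X (fderiv ℝ μ t (EuclideanSpace.single α 1)) q
        - Complex.I • comb X (fderiv ℝ lam t (EuclideanSpace.single β 1)) q) := by
  have : CompleteSpace E := FiniteDimensional.complete ℝ E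
  have h1 := (smoothOn_twist hX hlam).diffAt isOpen_univ (mem_univ (q, t))
  have h2 := (smoothOn_twist hX hμ).diffAt isOpen_univ (mem_univ (q, t))
  have h3 (α : Fin ℓ) := (smoothOn_coordField (E := E) α).diffAt isOpen_univ (mem_univ (q, t))
  rw [CField.bracket_add_left h1 ((h3 α).const_smul _),
    CField.bracket_add_right h2 ((h3 β).const_smul _),
    CField.bracket_add_right h2 ((h3 β).const_smul _),
    CField.bracket_const_smul_right _ (h3 β), CField.bracket_const_smul_right _ (h3 β),
    CField.bracket_const_smul_left _ (h3 α), CField.bracket_const_smul_left _ (h3 α),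
    bracket_twist_twist hX hlam hμ, bracket_twist_coordField hX hlam,
    CField.bracket_swap (coordField α), bracket_twist_coordField hX hμ,
    bracket_coordField_coordField, map_sub, map_add, map_smul, map_smul]
  module

end TwistedFields

/-! ### The extended `(0,1)`-spaces -/

section Extension

variable {E M : Type*} [NormedAddCommGroup E] [NormedSpace ℝ E] [FiniteDimensional ℝ E]
  [TopologicalSpace M] [ChartedSpace E M] [IsManifold 𝓘(ℝ, E) ∞ M] {n k s ℓ : ℕ}

omit [FiniteDimensional ℝ E] [IsManifold 𝓘(ℝ, E) ∞ M] in
theorem Yfield_eq_twist (c : Fin s → Fin s → Fin s → ℂ) (η : Fin ℓ → Fin s → ℂ)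
    (X : Fin s → CField 𝓘(ℝ, E) M) (α : Fin ℓ) :
    Yfield c η X α = twist X (fun t => maurerCartanCoeff c η (fun j => -Complex.I * (t j : ℂ)) α)
      + Complex.I • coordField α := by
  funext ⟨q, t⟩
  rw [Pi.add_apply, twist_apply, comb_apply]
  rfl

/-- The `(0,1)`-space of the extension at `z = (q, t)`: the lift of `D^{0,1}_q` together with the
values of the fields `Y_α`. -/
noncomputable def extendedD01 (S : CRStructure 𝓘(ℝ, E) (univ : Set M) n k)
    (X : Fin s → CField 𝓘(ℝ, E) M) (c : Fin s → Fin s → Fin s → ℂ) (η : Fin ℓ → Fin s → ℂ)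
    (z : M × EuclideanSpace ℝ (Fin ℓ)) :
    Submodule ℂ (ComplexVec (TangentSpace (prodModel E ℓ) z)) :=
  (S.D01 z.1).map (horizontal z.1 z.2) ⊔ Submodule.span ℂ (range fun α => Yfield c η X α z)

variable {S : CRStructure 𝓘(ℝ, E) (univ : Set M) n k} {X : Fin s → CField 𝓘(ℝ, E) M}
  {c : Fin s → Fin s → Fin s → ℂ} {η : Fin ℓ → Fin s → ℂ}

omit [FiniteDimensional ℝ E] in
theorem horizontal_mem_extendedD01 {q : M} {t : EuclideanSpace ℝ (Fin ℓ)}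
    {v : ComplexVec (TangentSpace 𝓘(ℝ, E) q)} (hv : v ∈ S.D01 q) :
    horizontal q t v ∈ extendedD01 S X c η (q, t) :=
  Submodule.mem_sup_left (Submodule.mem_map_of_mem hv)

omit [FiniteDimensional ℝ E] in
theorem Yfield_mem_extendedD01 (α : Fin ℓ) (z : M × EuclideanSpace ℝ (Fin ℓ)) :
    Yfield c η X α z ∈ extendedD01 S X c η z :=
  Submodule.mem_sup_right (Submodule.subset_span (mem_range_self α))

omit [FiniteDimensional ℝ E] in
theorem smoothOn_Yfield (hX : ∀ α, (X α).SmoothOn univ) (α : Fin ℓ) :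
    (Yfield c η X α).SmoothOn univ := by
  rw [Yfield_eq_twist]
  exact (smoothOn_twist hX (contDiff_maurerCartanCoeff η α)).add
    ((smoothOn_coordField α).const_smul _)

variable (hX : ∀ α, (X α).SmoothOn univ) (hnorm : ∀ α, S.Normalises (X α))

include hX hnorm in
theorem bracket_Yfield_liftField_mem {u : Set M} (hu : IsOpen u) {Z : CField 𝓘(ℝ, E) M}
    (hZ : Z.SmoothOn u) (hZS : ∀ y ∈ u, Z y ∈ S.D01 y) (α : Fin ℓ) {q : M} (hq : q ∈ u)
    (t : EuclideanSpace ℝ (Fin ℓ)) :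
    (Yfield c η X α).bracket (liftField ℓ Z) (q, t) ∈ extendedD01 S X c η (q, t) := by
  have : CompleteSpace E := FiniteDimensional.complete ℝ E
  have hω := contDiff_maurerCartanCoeff (c := c) η α
  have hZq := hZ.diffAt hu hq
  have hd := (smoothOn_coordField (E := E) α).diffAt isOpen_univ (mem_univ (q, t))
  rw [Yfield_eq_twist, CField.bracket_add_left ((smoothOn_twist hX hω).diffAt isOpen_univ
    (mem_univ _)) (hd.const_smul _), CField.bracket_const_smul_left _ hd,
    bracket_coordField_liftField α hZq, smul_zero, add_zero, bracket_twist_liftField hX hω hZq]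
  exact horizontal_mem_extendedD01
    (normalises_comb hX hnorm _ u (subset_univ _) hu Z hZ hZS q hq)

include hX hnorm in
/-- The Maurer–Cartan equation makes `Y_α` and `Y_β` commute modulo `D^{0,1}`. -/
theorem bracket_Yfield_Yfield_mem
    (hc : ∀ α β x, (X α).bracket (X β) x - ∑ γ, c α β γ • X γ x ∈ S.D01 x)
    (α β : Fin ℓ) (q : M) (t : EuclideanSpace ℝ (Fin ℓ)) :
    (Yfield c η X α).bracket (Yfield c η X β) (q, t) ∈ extendedD01 S X c η (q, t) := by
  wlog h : α < β generalizing α β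
  · rcases (not_lt.1 h).eq_or_lt with rfl | h'
    · rw [CField.bracket_self]
      exact zero_mem _
    · rw [CField.bracket_swap]
      exact neg_mem (this β α h')
  have hω (α : Fin ℓ) := contDiff_maurerCartanCoeff (c := c) η α
  rw [Yfield_eq_twist, Yfield_eq_twist, bracket_twist_add_coordField hX (hω α) (hω β),
    fderiv_maurerCartanCoeff_of_le η h.le]
  refine horizontal_mem_extendedD01 ?_
  have h1 := (isJacobiIdeal_sectionCoeffs hX hnorm hc).maurerCartan η h t q
  have h2 := bracket_comb_sub_mem hX hc
    (maurerCartanCoeff c η (fun j => -Complex.I * (t j : ℂ)) α)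
    (maurerCartanCoeff c η (fun j => -Complex.I * (t j : ℂ)) β) q
  rw [comb_add, comb_smul] at h1
  convert add_mem h2 h1 using 1
  have h0 : comb X (0 : Fin s → ℂ) q = 0 := by simp [comb_apply]
  rw [h0]
  simp only [Pi.add_apply, Pi.sub_apply, Pi.smul_apply]
  module

omit [FiniteDimensional ℝ E] in
/-- Near every point `D^{0,1}` has a smooth frame `e_i + i J e_i` over the reals, with `e_i`
independent. -/
theorem CRStructure.exists_realFrame_D01 (S : CRStructure 𝓘(ℝ, E) (univ : Set M) n k) (p : M) :
    ∃ u : Set M, IsOpen u ∧ p ∈ u ∧ ∃ Z : Fin (2 * n) → CField 𝓘(ℝ, E) M,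
      (∀ i, (Z i).SmoothOn u) ∧ (∀ i y, y ∈ u → Z i y ∈ S.D01 y) ∧
      (∀ y ∈ u, ∀ z ∈ S.D01 y, z ∈ Submodule.span ℝ (range fun i => Z i y)) ∧
      ∃ e : Fin (2 * n) → S.D p, (∀ i, (Z i p).re = e i) ∧ LinearIndependent ℝ e ∧
        Module.finrank ℝ (S.D p) = 2 * n := by
  obtain ⟨u, -, hu, hpu, e, he, hJe, hb⟩ := S.exists_frame p (mem_univ p)
  refine ⟨u, hu, hpu, fun i y => ⟨e i y, S.J y (e i y)⟩, fun i => ⟨he i, hJe i⟩,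
    fun i y _ => ⟨e i y, S.J y (e i y), rfl, rfl, S.J_sq y (mem_univ y) _⟩, ?_,
    fun i => e i p, fun i => rfl, (hb p hpu).1, ?_⟩
  · rintro y hy _ ⟨a, b, rfl, h1, -⟩
    have ha : a ∈ Submodule.span ℝ (range fun i => e i y) := by
      rw [(hb y hy).2]; exact Submodule.mem_top
    obtain ⟨r, rfl⟩ := (Submodule.mem_span_range_iff_exists_fun ℝ).1 ha
    refine (Submodule.mem_span_range_iff_exists_fun ℝ).2 ⟨r, ?_⟩
    ext1
    · rw [ComplexVec.re_sum_smul]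
      simp
    · rw [← ComplexVec.imₗ_apply, map_sum, ← h1, map_sum]
      simp
  · rw [← finrank_top ℝ (S.D p), ← (hb p hpu).2, finrank_span_eq_card (hb p hpu).1,
      Fintype.card_fin]

end Extension

/-! ### A frame of the extension over the reals -/

section RealFrame

variable {E M : Type*} [NormedAddCommGroup E] [NormedSpace ℝ E] [FiniteDimensional ℝ E]
  [TopologicalSpace M] [ChartedSpace E M] [IsManifold 𝓘(ℝ, E) ∞ M] {n k s ℓ m : ℕ}

/-- The frame over the reals of the `(0,1)`-spaces of the extension that is given by a frame `Z` of
`D^{0,1}`: the lifts of the `Z i`, the `Y_α` and the `-i Y_α`. -/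
noncomputable def extendedFrame (Z : Fin m → CField 𝓘(ℝ, E) M) (X : Fin s → CField 𝓘(ℝ, E) M)
    (c : Fin s → Fin s → Fin s → ℂ) (η : Fin ℓ → Fin s → ℂ) :
    (Fin m ⊕ Fin ℓ) ⊕ Fin ℓ → CField (prodModel E ℓ) (M × EuclideanSpace ℝ (Fin ℓ)) :=
  Sum.elim (Sum.elim (fun i => liftField ℓ (Z i)) (Yfield c η X))
    fun α => -Complex.I • Yfield c η X α

variable {S : CRStructure 𝓘(ℝ, E) (univ : Set M) n k} {X : Fin s → CField 𝓘(ℝ, E) M}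
  {c : Fin s → Fin s → Fin s → ℂ} {η : Fin ℓ → Fin s → ℂ} {Z : Fin m → CField 𝓘(ℝ, E) M}
  {u : Set M}

omit [FiniteDimensional ℝ E] in
theorem smoothOn_extendedFrame (hX : ∀ α, (X α).SmoothOn univ) (hZ : ∀ i, (Z i).SmoothOn u) (a) :
    (extendedFrame Z X c η a).SmoothOn (Prod.fst ⁻¹' u) := by
  have hY (α) : (Yfield c η X α).SmoothOn (Prod.fst ⁻¹' u) :=
    ⟨(smoothOn_Yfield hX α).1.mono (subset_univ _), (smoothOn_Yfield hX α).2.mono (subset_univ _)⟩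
  rcases a with (i | α) | α
  · exact smoothOn_liftField (hZ i)
  · exact hY α
  · exact (hY α).const_smul _

omit [FiniteDimensional ℝ E] in
theorem extendedFrame_mem (hZS : ∀ i y, y ∈ u → Z i y ∈ S.D01 y) (a) {q : M} (hq : q ∈ u)
    (t : EuclideanSpace ℝ (Fin ℓ)) :
    extendedFrame Z X c η a (q, t) ∈ extendedD01 S X c η (q, t) := by
  rcases a with (i | α) | α
  · exact horizontal_mem_extendedD01 (hZS i q hq)
  · exact Yfield_mem_extendedD01 α _
  · exact Submodule.smul_mem _ _ (Yfield_mem_extendedD01 α _)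

omit [FiniteDimensional ℝ E] in
theorem mem_span_extendedFrame {q : M}
    (hZ : ∀ z ∈ S.D01 q, z ∈ Submodule.span ℝ (range fun i => Z i q))
    {t : EuclideanSpace ℝ (Fin ℓ)}
    {z : ComplexVec (TangentSpace (prodModel E ℓ) ((q, t) : M × EuclideanSpace ℝ (Fin ℓ)))}
    (hz : z ∈ extendedD01 S X c η (q, t)) :
    z ∈ Submodule.span ℝ (range fun a => extendedFrame Z X c η a (q, t)) := by
  have hsub (a) := Submodule.subset_span (R := ℝ)
    (mem_range_self (f := fun a => extendedFrame Z X c η a (q, t)) a)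
  obtain ⟨_, ⟨w, hw, rfl⟩, y, hy, rfl⟩ := Submodule.mem_sup.1 hz
  refine add_mem ?_ ?_
  · obtain ⟨r, rfl⟩ := (Submodule.mem_span_range_iff_exists_fun ℝ).1 (hZ w hw)
    change horizontal q t _ ∈ _
    rw [map_sum]
    refine sum_mem fun i _ => ?_
    rw [LinearMap.map_smul_of_tower]
    exact Submodule.smul_mem _ _ (hsub (.inl (.inl i)))
  · obtain ⟨r, rfl⟩ := (Submodule.mem_span_range_iff_exists_fun ℂ).1 hy
    refine sum_mem fun α _ => ?_
    have h : r α • Yfield c η X α (q, t) = (r α).re • extendedFrame Z X c η (.inl (.inr α)) (q, t)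
        + (-(r α).im) • extendedFrame Z X c η (.inr α) (q, t) := by
      change _ = (r α).re • Yfield c η X α (q, t)
        + (-(r α).im) • (-Complex.I • Yfield c η X α (q, t))
      conv_lhs => rw [← Complex.re_add_im (r α)]
      rw [ComplexVec.real_smul_eq, ComplexVec.real_smul_eq]
      ext1
      · simp
        module
      · simp
    rw [h]
    exact add_mem (Submodule.smul_mem _ _ (hsub _)) (Submodule.smul_mem _ _ (hsub _))

theorem bracket_extendedFrame_mem (hX : ∀ α, (X α).SmoothOn univ)
    (hnorm : ∀ α, S.Normalises (X α))
    (hc : ∀ α β x, (X α).bracket (X β) x - ∑ γ, c α β γ • X γ x ∈ S.D01 x)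
    (hu : IsOpen u) (hZ : ∀ i, (Z i).SmoothOn u) (hZS : ∀ i y, y ∈ u → Z i y ∈ S.D01 y) (a b)
    {q : M} (hq : q ∈ u) (t : EuclideanSpace ℝ (Fin ℓ)) :
    (extendedFrame Z X c η a).bracket (extendedFrame Z X c η b) (q, t) ∈
      extendedD01 S X c η (q, t) := by
  have : CompleteSpace E := FiniteDimensional.complete ℝ E
  have hd (a) := (smoothOn_extendedFrame (c := c) (η := η) hX hZ (.inl a)).diffAt
    (hu.preimage continuous_fst) (show (q, t) ∈ Prod.fst ⁻¹' u from hq)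
  have key (a b) : (extendedFrame Z X c η (.inl a)).bracket (extendedFrame Z X c η (.inl b)) (q, t)
      ∈ extendedD01 S X c η (q, t) := by
    rcases a with i | α <;> rcases b with j | β
    · refine (congrArg (· ∈ extendedD01 S X c η (q, t)) (bracket_liftField_liftField
        ((hZ i).diffAt hu hq) ((hZ j).diffAt hu hq))).mpr ?_
      exact horizontal_mem_extendedD01
        (S.involutive u (subset_univ _) hu _ _ (hZ i) (hZ j) (hZS i) (hZS j) q hq)
    · rw [CField.bracket_swap]
      exact neg_mem (bracket_Yfield_liftField_mem hX hnorm hu (hZ i) (hZS i) β hq t)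
    · exact bracket_Yfield_liftField_mem hX hnorm hu (hZ j) (hZS j) α hq t
    · exact bracket_Yfield_Yfield_mem hX hnorm hc α β q t
  have key' (a β) : (extendedFrame Z X c η (.inl a)).bracket (extendedFrame Z X c η (.inr β)) (q, t)
      ∈ extendedD01 S X c η (q, t) := by
    refine (congrArg (· ∈ extendedD01 S X c η (q, t)) (CField.bracket_const_smul_right (-Complex.I)
      (hd (.inr β)))).mpr ?_
    exact Submodule.smul_mem _ _ (key a (.inr β))
  rcases a with a | α <;> rcases b with b | β
  · exact key a b
  · exact key' a β
  · rw [CField.bracket_swap]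
    exact neg_mem (key' b α)
  · refine (congrArg (· ∈ extendedD01 S X c η (q, t)) (CField.bracket_const_smul_left (-Complex.I)
      (hd (.inr α)))).mpr ?_
    exact Submodule.smul_mem _ _ (key' (.inr α) β)

omit [FiniteDimensional ℝ E] [IsManifold 𝓘(ℝ, E) ∞ M] in
theorem re_horizontal_add_coordField {z : M × EuclideanSpace ℝ (Fin ℓ)}
    (v : ComplexVec (TangentSpace 𝓘(ℝ, E) z.1)) (α : Fin ℓ) :
    (horizontal z.1 z.2 v + Complex.I • coordField α z).re =
      ((v.re, 0) : E × EuclideanSpace ℝ (Fin ℓ)) := by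
  refine Prod.ext ?_ ?_
  · change id (α := E) v.re + ((0 : ℝ) • (0 : E) - (1 : ℝ) • (0 : E)) = v.re
    simp
    rfl
  · change (0 : EuclideanSpace ℝ (Fin ℓ)) + ((0 : ℝ) • EuclideanSpace.single α 1 - (1 : ℝ) • 0) = 0
    simp

omit [FiniteDimensional ℝ E] [IsManifold 𝓘(ℝ, E) ∞ M] in
theorem im_horizontal_add_coordField {z : M × EuclideanSpace ℝ (Fin ℓ)}
    (v : ComplexVec (TangentSpace 𝓘(ℝ, E) z.1)) (α : Fin ℓ) :
    (horizontal z.1 z.2 v + Complex.I • coordField α z).im =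
      ((v.im, EuclideanSpace.single α 1) : E × EuclideanSpace ℝ (Fin ℓ)) := by
  refine Prod.ext ?_ ?_
  · change id (α := E) v.im + ((0 : ℝ) • (0 : E) + (1 : ℝ) • (0 : E)) = v.im
    simp
    rfl
  · change (0 : EuclideanSpace ℝ (Fin ℓ)) + ((0 : ℝ) • 0 + (1 : ℝ) • EuclideanSpace.single α 1) = _
    simp

theorem ComplexVec.re_neg_I_smul {V : Type*} [AddCommGroup V] [Module ℝ V] (z : ComplexVec V) :
    (-Complex.I • z).re = z.im := by
  simp

omit [FiniteDimensional ℝ E] [IsManifold 𝓘(ℝ, E) ∞ M] in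
/-- The real part of `-i Y_α` has the vertical component `∂/∂t^α`, so it needs no assumption. -/
theorem linearIndependent_re_extendedFrame {p : M}
    (h : LinearIndependent ℝ (Sum.elim (fun i => (Z i p).re) fun α => (comb X (η α) p).re)) :
    LinearIndependent ℝ fun a =>
      (extendedFrame Z X c η a ((p, 0) : M × EuclideanSpace ℝ (Fin ℓ))).re := by
  have hs : LinearIndependent ℝ fun α : Fin ℓ => EuclideanSpace.single α (1 : ℝ) := by
    refine Fintype.linearIndependent_iff.2 fun g hg α => ?_
    simpa [Pi.single_apply] using congrArg (fun v : EuclideanSpace ℝ (Fin ℓ) => v α) hg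
  have := linearIndependent_prod_lift (F := EuclideanSpace ℝ (Fin ℓ)) h
    (fun α => (comb X (η α) p).im) hs
  have hY (α) : Yfield c η X α (p, 0) = horizontal p 0 (comb X (η α) p)
      + Complex.I • coordField α (p, 0) := by
    rw [Yfield_eq_twist, Pi.add_apply, twist_apply, maurerCartanCoeff_zero]
    rfl
  refine (congrArg (fun v : _ → E × EuclideanSpace ℝ (Fin ℓ) => LinearIndependent ℝ v)
    (funext fun a => ?_)).mpr this
  rcases a with (i | α) | α
  · rfl
  · change (Yfield c η X α (p, 0)).re = _
    rw [hY]
    exact re_horizontal_add_coordField _ _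
  · change (-Complex.I • Yfield c η X α (p, 0)).re = _
    rw [hY, ComplexVec.re_neg_I_smul]
    exact im_horizontal_add_coordField _ _

end RealFrame

/-! ### The extension and its slice -/

section Slice

variable {E M : Type*} [NormedAddCommGroup E] [NormedSpace ℝ E]
  [TopologicalSpace M] [ChartedSpace E M] {n k n' k' ℓ : ℕ}

theorem mfderiv_prodMk_zero (q : M) (v : TangentSpace 𝓘(ℝ, E) q) :
    mfderiv 𝓘(ℝ, E) (prodModel E ℓ) (fun q : M => (q, (0 : EuclideanSpace ℝ (Fin ℓ)))) q v =
      ((v, 0) : E × EuclideanSpace ℝ (Fin ℓ)) := by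
  have h : mfderiv 𝓘(ℝ, E) (prodModel E ℓ) (fun q : M => (q, (0 : EuclideanSpace ℝ (Fin ℓ)))) q =
      (ContinuousLinearMap.id ℝ E).prod 0 :=
    ((hasMFDerivAt_id q).prodMk (hasMFDerivAt_const 0 q)).mfderiv
  rw [h]
  rfl

variable [IsManifold 𝓘(ℝ, E) ∞ M]

/-- If the `(0,1)`-spaces of a CR structure on `U × V` contain the lifts of those of `U` along
`t = 0`, then the slice `t = 0` is a CR embedding. -/
theorem isCREmbedding_slice (S : CRStructure 𝓘(ℝ, E) (univ : Set M) n k) {U : Set M}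
    (hU : IsOpen U) {V : Set (EuclideanSpace ℝ (Fin ℓ))} (hV : 0 ∈ V)
    (S' : CRStructure (prodModel E ℓ) (U ×ˢ V) n' k')
    (h : ∀ q ∈ U, (S.D01 q).map (horizontal q 0) ≤ S'.D01 (q, 0)) :
    IsCREmbedding (S.restrict U hU (subset_univ U)) S' (fun q => (q, 0)) where
  mapsTo q hq := ⟨hq, hV⟩
  smooth := (contMDiff_id.prodMk contMDiff_const).contMDiffOn
  isEmbedding := by
    refine Topology.IsEmbedding.comp (g := fun q : M => (q, (0 : EuclideanSpace ℝ (Fin ℓ))))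
      ?_ Topology.IsEmbedding.subtypeVal
    exact isEmbedding_prodMkLeft 0
  immersion q hq v w hvw := by
    rw [mfderiv_prodMk_zero, mfderiv_prodMk_zero] at hvw
    exact congrArg Prod.fst hvw
  map_J q hq v := by
    -- the lift of `v + i J v` lies in `D'^{0,1}`, which says that `J' (v, 0) = (J v, 0)`
    obtain ⟨a, b, hab, hJ, -⟩ := h q hq (Submodule.mem_map_of_mem
      (show (⟨(v : TangentSpace 𝓘(ℝ, E) q), S.J q v⟩ : ComplexVec (TangentSpace 𝓘(ℝ, E) q)) ∈
        S.D01 q from ⟨v, S.J q v, rfl, rfl, S.J_sq q (mem_univ q) v⟩))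
    have ha : (a.1 : E × EuclideanSpace ℝ (Fin ℓ)) = ((v : TangentSpace 𝓘(ℝ, E) q), 0) :=
      (congrArg ComplexVec.re hab).symm
    have hb : (b.1 : E × EuclideanSpace ℝ (Fin ℓ)) = ((S.J q v : TangentSpace 𝓘(ℝ, E) q), 0) :=
      (congrArg ComplexVec.im hab).symm
    rw [mfderiv_prodMk_zero, mfderiv_prodMk_zero]
    have hmem : ((v : TangentSpace 𝓘(ℝ, E) q), (0 : EuclideanSpace ℝ (Fin ℓ))) ∈ S'.D (q, 0) := by
      have := a.2
      rw [ha] at this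
      exact this
    refine ⟨hmem, ?_⟩
    have : (⟨_, hmem⟩ : S'.D (q, 0)) = a := Subtype.ext ha.symm
    exact (congrArg Subtype.val ((congrArg (S'.J (q, 0)) this).trans hJ)).trans hb

end Slice

section Main

variable {E M : Type*} [NormedAddCommGroup E] [NormedSpace ℝ E] [FiniteDimensional ℝ E]
  [TopologicalSpace M] [ChartedSpace E M] [IsManifold 𝓘(ℝ, E) ∞ M] {n k s ℓ : ℕ}

/-- Where the real parts of a frame of `D^{0,1}` and of the `η_α`-combinations of the `X γ` are
independent, the spaces `extendedD01` are the `(0,1)`-spaces of a CR structure. -/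
theorem exists_extension (S : CRStructure 𝓘(ℝ, E) (univ : Set M) n k)
    {X : Fin s → CField 𝓘(ℝ, E) M} (hX : ∀ α, (X α).SmoothOn univ)
    (hnorm : ∀ α, S.Normalises (X α)) {c : Fin s → Fin s → Fin s → ℂ}
    (hc : ∀ α β x, (X α).bracket (X β) x - ∑ γ, c α β γ • X γ x ∈ S.D01 x) (hℓ : ℓ ≤ k)
    (η : Fin ℓ → Fin s → ℂ) {p : M} {u : Set M} (hu : IsOpen u) (hpu : p ∈ u)
    {Z : Fin (2 * n) → CField 𝓘(ℝ, E) M} (hZ : ∀ i, (Z i).SmoothOn u)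
    (hZS : ∀ i y, y ∈ u → Z i y ∈ S.D01 y)
    (hspan : ∀ y ∈ u, ∀ z ∈ S.D01 y, z ∈ Submodule.span ℝ (range fun i => Z i y))
    (hli : LinearIndependent ℝ (Sum.elim (fun i => (Z i p).re) fun α => (comb X (η α) p).re)) :
    ∃ (U : Set M) (V : Set (EuclideanSpace ℝ (Fin ℓ)))
      (S' : CRStructure (prodModel E ℓ) (U ×ˢ V) (n + ℓ) (k - ℓ)),
      IsOpen U ∧ p ∈ U ∧ IsOpen V ∧ 0 ∈ V ∧
      ∀ q ∈ U, ∀ t ∈ V, S'.D01 (q, t) = extendedD01 S X c η (q, t) := by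
  let ν : Fin (2 * (n + ℓ)) ≃ (Fin (2 * n) ⊕ Fin ℓ) ⊕ Fin ℓ :=
    Fintype.equivOfCardEq (by simp; ring)
  let F (i : Fin (2 * (n + ℓ))) := extendedFrame Z X c η (ν i)
  have hF (i) : (F i).SmoothOn (Prod.fst ⁻¹' u) := smoothOn_extendedFrame hX hZ _
  -- independence of the real parts is an open condition
  have hev := eventually_linearIndependent
    (fun i => ((hF i).diffAt (hu.preimage continuous_fst)
      (show (p, (0 : EuclideanSpace ℝ (Fin ℓ))) ∈ Prod.fst ⁻¹' u from hpu)).1)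
    ((linearIndependent_re_extendedFrame (c := c) (η := η) hli).comp ν ν.injective)
  obtain ⟨U, hU, V, hV, hUV⟩ := mem_nhds_prod_iff.1 hev
  obtain ⟨U', hU', hU'o, hpU'⟩ := mem_nhds_iff.1 hU
  obtain ⟨V', hV', hV'o, h0V'⟩ := mem_nhds_iff.1 hV
  have hsub : (U' ∩ u) ×ˢ V' ⊆ Prod.fst ⁻¹' u := fun z hz => hz.1.2
  have hopen : IsOpen ((U' ∩ u) ×ˢ V') := (hU'o.inter hu).prod hV'o
  have hdim : Module.finrank ℝ (E × EuclideanSpace ℝ (Fin ℓ)) = 2 * (n + ℓ) + (k - ℓ) := by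
    rw [Module.finrank_prod, S.dim_eq, finrank_euclideanSpace_fin]
    omega
  refine (exists_crStructure_of_frames (I := prodModel E ℓ) hopen hdim (extendedD01 S X c η)
    fun z hz => ⟨_, subset_rfl, hopen, hz, F, fun i => ⟨(hF i).1.mono hsub, (hF i).2.mono hsub⟩,
      fun y hy => ⟨?_, ?_, ?_, ?_⟩⟩).elim fun S' hS' => ⟨U' ∩ u, V', S', hU'o.inter hu,
        ⟨hpU', hpu⟩, hV'o, h0V', fun q hq t ht => hS' (q, t) ⟨hq, ht⟩⟩
  · exact hUV ⟨hU' hy.1.1, hV' hy.2⟩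
  · exact fun i => extendedFrame_mem hZS _ hy.1.2 _
  · intro w hw
    have hr : range (fun i => F i y) = range fun a => extendedFrame Z X c η a y :=
      ν.surjective.range_comp fun a => extendedFrame Z X c η a y
    rw [hr]
    exact mem_span_extendedFrame (hspan y.1 hy.1.2) hw
  · exact fun i j => bracket_extendedFrame_mem hX hnorm hc hu hZ hZS _ _ hy.1.2 _

end Main

theorem mainTheorem1
    {E : Type*} [NormedAddCommGroup E] [NormedSpace ℝ E] [FiniteDimensional ℝ E]
    {M : Type*} [TopologicalSpace M] [ChartedSpace E M] [IsManifold 𝓘(ℝ, E) ∞ M]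
    {n k s ℓ : ℕ}
    (S : CRStructure 𝓘(ℝ, E) (univ : Set M) n k)
    (X : Fin s → CField 𝓘(ℝ, E) M)
    (hX_smooth : ∀ α, (X α).SmoothOn univ)
    (hX_ne : ∀ α x, X α x ≠ 0)
    (hX_norm : ∀ α, S.Normalises (X α))
    (c : Fin s → Fin s → Fin s → ℂ)
    (hX_bracket : ∀ α β x,
      (X α).bracket (X β) x - ∑ γ, c α β γ • X γ x ∈ S.D01 x)
    (hX_rank : ∀ x, Module.finrank ℂ
      ↥(S.D01 x ⊔ Submodule.span ℂ (range fun α => X α x)) = n + ℓ)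
    (p : M)
    (hX_transverse :
      (S.D01 p ⊔ Submodule.span ℂ (range fun α => X α p)) ⊓ S.DC p = S.D01 p) :
    ∃ (U : Set M) (hU : IsOpen U) (V : Set (EuclideanSpace ℝ (Fin ℓ)))
      (σ : Fin ℓ → Fin s) (ε : Fin ℓ → ℂ)
      (S' : CRStructure (prodModel E ℓ) (U ×ˢ V) (n + ℓ) (k - ℓ)),
      p ∈ U ∧ IsOpen V ∧ 0 ∈ V ∧ ℓ ≤ k ∧
      Function.Injective σ ∧ (∀ α, ε α = 1 ∨ ε α = Complex.I) ∧
      (∀ q ∈ U, ∀ t ∈ V, S'.D01 (q, t) =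
        (S.D01 q).map (horizontal q t) ⊔
          Submodule.span ℂ (range fun α =>
            Yfield c (fun j => Pi.single (σ j) (ε j)) X α (q, t))) ∧
      IsCREmbedding (S.restrict U hU (subset_univ U)) S' (fun q => (q, 0)) := by
  obtain ⟨u, hu, hpu, Z, hZ, hZS, hspan, e, hZe, he, hD⟩ := S.exists_realFrame_D01 p
  have : FiniteDimensional ℝ (TangentSpace 𝓘(ℝ, E) p) := inferInstanceAs (FiniteDimensional ℝ E)
  obtain ⟨σ, ε, hσ, hε, hli⟩ := exists_selection (D := S.D p) (L := S.D01 p) (fun α => X α p)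
    (by rintro _ ⟨a, b, rfl, -, -⟩; exact ⟨a.2, b.2⟩)
    (finrank_antiHolomorphic (S.J_sq p (mem_univ p)) hD) (hX_rank p)
    (fun z hz hre him => hX_transverse.le ⟨hz, hre, him⟩)
  -- there are `ℓ` independent vectors in the quotient of `T_p M` by `D_p`, of dimension `k`
  have hℓ : ℓ ≤ k := by
    have h1 := hli.fintype_card_le_finrank
    have h2 := Submodule.finrank_quotient_add_finrank (S.D p)
    have h3 : Module.finrank ℝ (TangentSpace 𝓘(ℝ, E) p) = 2 * n + k := S.dim_eq
    rw [Fintype.card_fin] at h1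
    omega
  have hcomb (α) : comb X (Pi.single (σ α) (ε α)) p = ε α • X (σ α) p := by
    rw [comb_apply, Finset.sum_eq_single (σ α) (fun γ _ hγ => by simp [hγ]) (by simp)]
    simp
  have hli' : LinearIndependent ℝ (Sum.elim (fun i => (Z i p).re)
      fun α => (comb X (Pi.single (σ α) (ε α)) p).re) := by
    simp only [hcomb, hZe]
    exact he.sumElim_of_quotient _ hli
  obtain ⟨U, V, S', hU, hpU, hV, h0V, hS'⟩ := exists_extension S hX_smooth hX_norm hX_bracket hℓ
    (fun α => Pi.single (σ α) (ε α)) hu hpu hZ hZS hspan hli'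
  refine ⟨U, hU, V, σ, ε, S', hpU, hV, h0V, hℓ, hσ, hε, hS', ?_⟩
  exact isCREmbedding_slice S hU h0V S' fun q hq => by
    rw [hS' q hq 0 h0V]
    exact le_sup_left
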